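/- **Setting.** Let $N\ge 2$, $q\in\mathbb C$ with $0<|q|<1$; fix a value of $\log q$ and put $q^x=e^{x\log q}$, $[x]=\frac{q^x-q^{-x}}{q-q^{-1}}$. Let $(A_{i,j})_{1\le i,j\le N}$ be the Cartan matrix of $sl(N|1)$: $A_{i,i}=2$ $(i<N)$, $A_{N,N}=0$, $A_{i,i\pm1}=-1$, other entries $0$; $\nu_1=\dots=\nu_N=1$, $\nu_{N+1}=-1$. Let the level $k\in\mathbb C$ be such that $[(k+N-1)m]\ne0$ for every nonzero integer $m$ (in particular $k\neq -N+1$). *Bosons.* Take bosons $a^j_m,Q_a^j$ $(1\le j\le N)$ and $b^{i,j}_m,Q_b^{i,j},c^{i,j}_m,Q_c^{i,j}$ $(1\le i<j\le N+1)$, $m\in\mathbb Z$, whose nonzero commutators are, for nonzero modes, $[a^i_m,a^j_n]=\frac{[(k+N-1)m][A_{i,j}m]}{m}\delta_{m+n,0}$, $[b^{i,j}_m,b^{i,j}_n]=-\nu_i\nu_j\frac{[m]^2}{m}\delta_{m+n,0}$, $[c^{i,j}_m,c^{i,j}_n]=\nu_i\nu_j\frac{[m]^2}{m}\delta_{m+n,0}$;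 for zero modes $[a_0^i,Q_a^j]=(k+N-1)A_{i,j}$, $[b_0^{i,j},Q_b^{i,j}]=-\nu_i\nu_j$, $[c_0^{i,j},Q_c^{i,j}]=\nu_i\nu_j$; and $[Q_b^{i,N+1},Q_b^{j,N+1}]=\pi\sqrt{-1}$ for $i<j$. They act on the direct sum, over all complex eigenvalues $p$ of the zero modes $x_0$, of the boson Fock spaces $F(p)$ generated by the modes with $m<0$ from $|p\rangle$, which the modes with $m>0$ annihilate. Normal ordering $:\ :$ puts $Q$'s and modes with $m<0$ to the left of modes with $m\ge0$. For $x=a^i,b^{i,j},c^{i,j}$ put $$x(z)=-\sum_{m\ne0}\frac{x_m}{[m]}z^{-m}+Q_x+x_0\log z,\qquad x_\pm(z)=\pm(q-q^{-1})\sum_{\pm m>0}x_mz^{-m}\pm x_0\log q,$$ $$\Big(\tfrac{\gamma_1}{\beta_1}\cdots\tfrac{\gamma_r}{\beta_r}a^j\Big)(z|\alpha)=-\sum_{m\neq0}\frac{[\gamma_1m]\cdots[\gamma_rm]}{[\beta_1m]\cdots[\beta_rm]}\frac{a^j_m}{[m]}q^{-\alpha|m|}z^{-m}+\frac{\gamma_1\cdots\gamma_r}{\beta_1\cdots\beta_r}(Q_a^j+a_0^j\log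 z).$$ Any $b^{i,j}$ or $c^{i,j}$ whose indices violate $1\le i<j\le N+1$ is $0$; $(b+c)^{i,j}=b^{i,j}+c^{i,j}$. *The operators $h_{i,m}$.* For $1\le i\le N-1$, $$h_{i,m}=q^{-\frac{N-1}2|m|}a^i_m+\sum_{l=1}^i\big(q^{-(\frac k2+l-1)|m|}b_m^{l,i+1}-q^{-(\frac k2+l)|m|}b_m^{l,i}\big)+\sum_{l=i+1}^N\big(q^{-(\frac k2+l)|m|}b_m^{i,l}-q^{-(\frac k2+l-1)|m|}b_m^{i+1,l}\big)+q^{-(\frac k2+N)|m|}b_m^{i,N+1}-q^{-(\frac k2+N-1)|m|}b_m^{i+1,N+1},$$ $$h_{N,m}=q^{-\frac{N-1}2|m|}a_m^N-\sum_{l=1}^{N-1}q^{-(\frac k2+l)|m|}\big(b_m^{l,N}+b_m^{l,N+1}\big).$$ *The currents $X_i^\pm(z)$.* With $Y=\,:\!e^{y}\!:$ for the exponents $y$ below, and $1\le i\le N-1$, $$X_i^+(z)=\frac1{(q-q^{-1})z}\sum_{j=1}^i(X_i^{+(j,1)}-X_i^{+(j,2)}),\qquad X_N^+(z)=q^{N-2}\sum_{j=1}^NX_N^{+(j,0)},$$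 $$X_i^-(z)=\frac1{(q-q^{-1})z}\Big(\sum_{j=1}^{i}-\sum_{j=i+1}^{N-1}\Big)(X_i^{-(j,1)}-X_i^{-(j,2)})+q^{k+N-1}X_i^{-(N,0)},$$ $$X_N^-(z)=\frac1{(q-q^{-1})z}\sum_{j=1}^Nq^{-N+j+1}(-X_N^{-(j,1)}+X_N^{-(j,2)}).$$ Put $s=\frac{k+N-1}2$ and, for an index $r$, $T^\mp_{i,r}(z)=\sum_{l=r}^N\big(b_\mp^{i,l}(q^{\mp(k+l)}z)-b_\mp^{i+1,l}(q^{\mp(k+l-1)}z)\big)+b_\mp^{i,N+1}(q^{\mp(k+N)}z)-b_\mp^{i+1,N+1}(q^{\mp(k+N-1)}z)$. The exponents are as follows. - $X_i^{+(j,1)}$, $j\le i$: $(b+c)^{j,i}(q^{j-1}z)+b_+^{j,i+1}(q^{j-1}z)-(b+c)^{j,i+1}(q^jz)+\sum_{l=1}^{j-1}(b_+^{l,i+1}(q^{l-1}z)-b_+^{l,i}(q^lz))$. For $X_i^{+(j,2)}$ replace $b_+^{j,i+1}(q^{j-1}z)$ by $b_-^{j,i+1}(q^{j-1}z)$ and $(b+c)^{j,i+1}(q^jz)$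 by $(b+c)^{j,i+1}(q^{j-2}z)$. - $X_N^{+(j,0)}$: $(b+c)^{j,N}(q^{j-1}z)+b^{j,N+1}(q^{j-1}z)-\sum_{l=1}^{j-1}(b_+^{l,N+1}(q^lz)+b_+^{l,N}(q^lz))$. - $X_i^{-(j,1)}$, $j<i$: $a_-^i(q^{-s}z)+(b+c)^{j,i+1}(q^{-k-j}z)-b_-^{j,i}(q^{-k-j}z)-(b+c)^{j,i}(q^{-k-j+1}z)+\sum_{l=j+1}^i(b_-^{l,i+1}(q^{-k-l+1}z)-b_-^{l,i}(q^{-k-l}z))+T^-_{i,i+1}(z)$. For $X_i^{-(j,2)}$ replace $b_-^{j,i}(q^{-k-j}z)$ by $b_+^{j,i}(q^{-k-j}z)$ and $(b+c)^{j,i}(q^{-k-j+1}z)$ by $(b+c)^{j,i}(q^{-k-j-1}z)$. - $X_i^{-(i,1)}$: $a_-^i(q^{-s}z)+(b+c)^{i,i+1}(q^{-k-i}z)+T^-_{i,i+1}(z)$; $X_i^{-(i,2)}$: $a_+^i(q^{s}z)+(b+c)^{i,i+1}(q^{k+i}z)+T^+_{i,i+1}(z)$. - $X_i^{-(j,1)}$,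 $i<j\le N-1$: $a_+^i(q^sz)+(b+c)^{i,j+1}(q^{k+j}z)+b_+^{i+1,j+1}(q^{k+j}z)-(b+c)^{i+1,j+1}(q^{k+j+1}z)+T^+_{i,j+1}(z)$. For $X_i^{-(j,2)}$ replace $b_+^{i+1,j+1}$ by $b_-^{i+1,j+1}$ and $(b+c)^{i+1,j+1}(q^{k+j+1}z)$ by $(b+c)^{i+1,j+1}(q^{k+j-1}z)$. - $X_i^{-(N,0)}$: $a_+^i(q^sz)-b^{i,N+1}(q^{k+N-1}z)-b_+^{i+1,N+1}(q^{k+N-1}z)+b^{i+1,N+1}(q^{k+N}z)$. - $X_N^{-(j,1)}$, $j<N$: $a_-^N(q^{-s}z)-b_-^{j,N}(q^{-k-j}z)-(b+c)^{j,N}(q^{-k-j+1}z)-b_-^{j,N+1}(q^{-k-j}z)-b^{j,N+1}(q^{-k-j+1}z)-\sum_{l=j+1}^{N-1}(b_-^{l,N}(q^{-k-l}z)+b_-^{l,N+1}(q^{-k-l}z))$. For $X_N^{-(j,2)}$ replace $b_-^{j,N},b_-^{j,N+1}$ by $b_+^{j,N},b_+^{j,N+1}$, and $(b+c)^{j,N}(q^{-k-j+1}z),b^{j,N+1}(q^{-k-j+1}z)$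 by the same fields at $q^{-k-j-1}z$. - $X_N^{-(N,1)}$: $a_-^N(q^{-s}z)-b^{N,N+1}(q^{-k-N+1}z)$; $X_N^{-(N,2)}$: $a_+^N(q^sz)-b^{N,N+1}(q^{k+N-1}z)$. *Elementary vertex operators.* For $l_a=(l_a^1,\dots,l_a^N)\in\mathbb C^N$ and $\beta\in\mathbb C$, $$\phi^{l_a}(z|\beta)=\,:\exp\Big(\sum_{i,j=1}^N\Big(\frac{l_a^i}{k+N-1}\,\frac{\min(i,j)}{N-1}\,\frac{N-1-\max(i,j)}{1}\,a^j\Big)(z|\beta)\Big):.$$ **Proposition.** For all $l_a\in\mathbb C^N$ and $1\le i\le N$, the following identities of formal series of operators hold (powers of $z,z_1,z_2$ may have complex exponents). 1. For all $\beta\in\mathbb C$ and all integers $m\neq0$, $$[h_{i,m},\phi^{l_a}(z|\beta)]=\frac{[l_a^im]}{m}\,q^{-(\beta+\frac{N-1}2)|m|}z^m\,\phi^{l_a}(z|\beta),$$ and $[h_{i,0},\phi^{l_a}(z|\beta)]=l_a^i\,\phi^{l_a}(z|\beta)$. 2. For all $\beta\in\mathbb C$, $[X_i^+(z_1),\phi^{l_a}(z_2|\beta)]=0$.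 3. $$(z_1-q^{l_a^i}z_2)\,X_i^-(z_1)\,\phi^{l_a}\Big(z_2\Big|-\frac{k+N-1}2\Big)=(q^{l_a^i}z_1-z_2)\,\phi^{l_a}\Big(z_2\Big|-\frac{k+N-1}2\Big)\,X_i^-(z_1).$$ -/

import Mathlib

namespace SuperFock

noncomputable section

/-! Throughout, `N` is the rank, `ℓ` is a fixed value of `log q`, so that `q ^ x = exp (x ℓ)` for complex
`x`, and `k` is the level. All indices are the 1-based indices of the usual presentation. -/

/-- `q ^ x`, where `ℓ = log q`. -/
def qPow (ℓ x : ℂ) : ℂ := Complex.exp (x * ℓ)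

/-- The `q`-number `[x] = (q ^ x - q ^ (-x)) / (q - q⁻¹)`. -/
def qInt (ℓ x : ℂ) : ℂ := (qPow ℓ x - qPow ℓ (-x)) / (qPow ℓ 1 - qPow ℓ (-1))

/-- The Cartan matrix `A_{i,j}` of `sl(N|1)`, `1 ≤ i, j ≤ N`. -/
def cartan (N i j : ℕ) : ℤ :=
  if i = j then (if i = N then 0 else 2)
  else if i = j + 1 ∨ j = i + 1 then -1 else 0

/-- The signs `ν_1 = ⋯ = ν_N = 1`, `ν_{N+1} = -1`. -/
def nu (N j : ℕ) : ℂ := if j = N + 1 then -1 else 1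

/-! ### Bosons -/

/-- The indices `1 ≤ i ≤ N`. -/
abbrev Idx (N : ℕ) : Type := ↥(Finset.Icc 1 N)

/-- The pairs `(i, j)` with `1 ≤ i < j ≤ N + 1`. -/
abbrev Pair (N : ℕ) : Type :=
  ↥((Finset.Icc 1 (N + 1) ×ˢ Finset.Icc 1 (N + 1)).filter (fun p => p.1 < p.2))

/-- The families of bosons: `a^i`, `b^{i,j}`, `c^{i,j}`, in this order. -/
abbrev Boson (N : ℕ) : Type := Idx N ⊕ Pair N ⊕ Pair N

/-- `oscComm x y m` is the scalar `[x_m, y_{-m}]`, `m ≠ 0`. -/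
def oscComm (N : ℕ) (ℓ k : ℂ) : Boson N → Boson N → ℤ → ℂ
  | .inl i, .inl j, m =>
      qInt ℓ ((k + N - 1) * m) * qInt ℓ ((cartan N i j : ℂ) * m) / m
  | .inr (.inl p), .inr (.inl p'), m =>
      if p = p' then -(nu N p.1.1 * nu N p.1.2) * qInt ℓ m ^ 2 / m else 0
  | .inr (.inr p), .inr (.inr p'), m =>
      if p = p' then nu N p.1.1 * nu N p.1.2 * qInt ℓ m ^ 2 / m else 0
  | _, _, _ => 0

/-- `zeroComm x y` is the scalar `[x_0, Q_y]`. -/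
def zeroComm (N : ℕ) (k : ℂ) : Boson N → Boson N → ℂ
  | .inl i, .inl j => (k + N - 1) * (cartan N i j : ℂ)
  | .inr (.inl p), .inr (.inl p') => if p = p' then -(nu N p.1.1 * nu N p.1.2) else 0
  | .inr (.inr p), .inr (.inr p') => if p = p' then nu N p.1.1 * nu N p.1.2 else 0
  | _, _ => 0

/-! ### Fock space -/

/-- Polynomials in the creation operators: the variable `(x, n)` stands for `x_{-n}`. -/
abbrev Osc (N : ℕ) : Type := MvPolynomial (Boson N × ℕ+) ℂ

/-- A momentum: the eigenvalue of every zero mode `x_0`. -/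
abbrev Momentum (N : ℕ) : Type := Boson N → ℂ

/-- The direct sum of the boson Fock spaces `F(p)` over all complex momenta `p`;
`Finsupp.single p 1` is the vector `|p⟩`. -/
abbrev Fock (N : ℕ) : Type := Momentum N →₀ Osc N

/-- The action of the mode `x_m`, `m ≠ 0`, on a single Fock space: multiplication by a variable
for `m < 0`, and for `m > 0` the derivation that kills `1` and has
`[x_m, y_{-n}] = δ_{m,n} oscComm x y m`. -/
def osc (N : ℕ) (ℓ k : ℂ) (x : Boson N) (m : ℤ) : Module.End ℂ (Osc N) :=
  if 0 < m then
    (MvPolynomial.mkDerivation ℂ (fun y : Boson N × ℕ+ =>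
      if (y.2 : ℤ) = m then (MvPolynomial.C (oscComm N ℓ k x y.1 m) : Osc N) else 0)).toLinearMap
  else if m < 0 then
    LinearMap.mulLeft ℂ (MvPolynomial.X (x, m.natAbs.toPNat'))
  else 0

/-- The operator `x_m` on the Fock space; `x_0` acts on `F(p)` by the scalar `p x`. -/
def mode (N : ℕ) (ℓ k : ℂ) (x : Boson N) (m : ℤ) : Module.End ℂ (Fock N) :=
  Finsupp.lsum ℂ (fun p : Momentum N =>
    Finsupp.lsingle p ∘ₗ (if m = 0 then p x • LinearMap.id else osc N ℓ k x m))

/-! ### Fields linear in the bosons -/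

/-- The symbols that occur in a field linear in the bosons: `mode x m` is `x_m z^{-m}`
(including `x_0`), `Q x` is `Q_x`, and `zlog x` is `x_0 log z`. -/
inductive Sym (N : ℕ) : Type
  | mode (x : Boson N) (m : ℤ)
  | Q (x : Boson N)
  | zlog (x : Boson N)

/-- A (possibly infinite) formal linear combination of the symbols. -/
abbrev LinField (N : ℕ) : Type := Sym N → ℂ

/-- The field `x(z) = -∑_{m ≠ 0} x_m / [m] z^{-m} + Q_x + x_0 log z`. -/
def full (N : ℕ) (ℓ : ℂ) (x : Boson N) : LinField N
  | .mode y m => if y = x ∧ m ≠ 0 then -1 / qInt ℓ m else 0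
  | .Q y => if y = x then 1 else 0
  | .zlog y => if y = x then 1 else 0

/-- The field `x_+(z) = (q - q⁻¹) ∑_{m > 0} x_m z^{-m} + x_0 log q`. -/
def plusPart (N : ℕ) (ℓ : ℂ) (x : Boson N) : LinField N
  | .mode y m =>
      if y = x then
        (if 0 < m then qPow ℓ 1 - qPow ℓ (-1) else if m = 0 then ℓ else 0)
      else 0
  | .Q _ => 0
  | .zlog _ => 0

/-- The field `x_-(z) = -(q - q⁻¹) ∑_{m < 0} x_m z^{-m} - x_0 log q`. -/
def minusPart (N : ℕ) (ℓ : ℂ) (x : Boson N) : LinField N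
  | .mode y m =>
      if y = x then
        (if m < 0 then -(qPow ℓ 1 - qPow ℓ (-1)) else if m = 0 then -ℓ else 0)
      else 0
  | .Q _ => 0
  | .zlog _ => 0

/-- The field `(γ₁/β₁ ⋯ γ_r/β_r x)(z | α)`, that is
`-∑_{m ≠ 0} ([γ₁ m] ⋯ [γ_r m]) / ([β₁ m] ⋯ [β_r m]) x_m / [m] q^{-α|m|} z^{-m}
  + (γ₁ ⋯ γ_r) / (β₁ ⋯ β_r) (Q_x + x_0 log z)`. -/
def ratioField (N : ℕ) (ℓ : ℂ) (γ β : List ℂ) (x : Boson N) (α : ℂ) : LinField N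
  | .mode y m =>
      if y = x ∧ m ≠ 0 then
        -((γ.map (fun g => qInt ℓ (g * m))).prod / (β.map (fun b => qInt ℓ (b * m))).prod)
          / qInt ℓ m * qPow ℓ (-α * |m|)
      else 0
  | .Q y => if y = x then γ.prod / β.prod else 0
  | .zlog y => if y = x then γ.prod / β.prod else 0

/-- The substitution `z ↦ q ^ s z`. -/
def rescale {N : ℕ} (ℓ s : ℂ) (f : LinField N) : LinField N
  | .mode x m => qPow ℓ (-s * m) * f (.mode x m) + (if m = 0 then s * ℓ * f (.zlog x) else 0)
  | .Q x => f (.Q x)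
  | .zlog x => f (.zlog x)

/-! ### Normally ordered exponentials -/

/-- The coefficient of `w ^ n` in `exp (∑_{m ≥ 1} u_m w ^ m)`. -/
def expCoeff {R : Type*} [Ring R] [Algebra ℂ R] (u : ℕ → R) (n : ℕ) : R :=
  ∑ r ∈ Finset.range (n + 1), ((r.factorial : ℂ)⁻¹) •
    PowerSeries.coeff n ((PowerSeries.mk (fun m => if m = 0 then 0 else u m)) ^ r)

/-- The coefficient of `z ^ n` in `exp (∑_{m < 0} f_m z^{-m})`. -/
def creation (N : ℕ) (ℓ k : ℂ) (f : LinField N) (n : ℕ) : Module.End ℂ (Osc N) :=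
  expCoeff (fun m : ℕ => ∑ x : Boson N, f (.mode x (-(m : ℤ))) • osc N ℓ k x (-(m : ℤ))) n

/-- The coefficient of `z ^ (-n)` in `exp (∑_{m > 0} f_m z^{-m})`. -/
def annihilation (N : ℕ) (ℓ k : ℂ) (f : LinField N) (n : ℕ) : Module.End ℂ (Osc N) :=
  expCoeff (fun m : ℕ => ∑ x : Boson N, f (.mode x (m : ℤ)) • osc N ℓ k x (m : ℤ)) n

/-- The weight `∑ n` of a monomial `∏ x_{-n}`. -/
def wt {N : ℕ} (s : Boson N × ℕ+ →₀ ℕ) : ℕ := s.sum (fun y e => e * (y.2 : ℕ))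

/-- Polynomials all of whose monomials have weight less than `w`. -/
def lowWeight (N w : ℕ) : Submodule ℂ (Osc N) :=
  Submodule.span ℂ {v | ∃ s : Boson N × ℕ+ →₀ ℕ, wt s < w ∧ v = MvPolynomial.monomial s 1}

theorem osc_lowWeight (N : ℕ) (ℓ k : ℂ) (x : Boson N) (m w : ℕ) (hm : m ≠ 0) :
    ∀ v ∈ lowWeight N w, osc N ℓ k x (m : ℤ) v ∈ lowWeight N (w - m) := by
  intro v hv
  have hm' : (0 : ℤ) < (m : ℤ) := by omega
  refine Submodule.span_induction (p := fun v _ => osc N ℓ k x (m : ℤ) v ∈ lowWeight N (w - m))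
    ?_ ?_ ?_ ?_ hv
  · rintro _ ⟨s, hs, rfl⟩
    simp only [osc, if_pos hm', Derivation.coeFn_coe,
      MvPolynomial.mkDerivation_monomial, one_smul]
    refine Submodule.sum_mem _ (fun y hy => ?_)
    beta_reduce
    by_cases hym : (y.2 : ℤ) = m
    · rw [if_pos hym, smul_eq_mul, mul_comm, MvPolynomial.C_mul_monomial]
      have h1 : MvPolynomial.monomial (s - Finsupp.single y 1)
          (oscComm N ℓ k x y.1 m * (s y : ℂ)) =
          (oscComm N ℓ k x y.1 m * (s y : ℂ)) •
            (MvPolynomial.monomial (s - Finsupp.single y 1) (1 : ℂ) : Osc N) := by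
        rw [MvPolynomial.smul_monomial, smul_eq_mul, mul_one]
      rw [h1]
      refine Submodule.smul_mem _ _ (Submodule.subset_span ⟨_, ?_, rfl⟩)
      have hle : Finsupp.single y 1 ≤ s := by
        rw [Finsupp.single_le_iff]
        exact Nat.one_le_iff_ne_zero.2 (Finsupp.mem_support_iff.1 hy)
      have hw : wt s = wt (s - Finsupp.single y 1) + (y.2 : ℕ) := by
        conv_lhs => rw [← tsub_add_cancel_of_le hle]
        unfold wt
        rw [Finsupp.sum_add_index' (by simp) (by intros; ring)]
        simp
      have hym2 : (y.2 : ℕ) = m := by exact_mod_cast hym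
      omega
    · rw [if_neg hym, smul_zero]
      exact Submodule.zero_mem _
  · simp
  · intro a b _ _ ha hb
    rw [map_add]
    exact Submodule.add_mem _ ha hb
  · intro c a _ ha
    rw [map_smul]
    exact Submodule.smul_mem _ _ ha

theorem annihilation_lowWeight (N : ℕ) (ℓ k : ℂ) (f : LinField N) (n w : ℕ) :
    ∀ v ∈ lowWeight N w, annihilation N ℓ k f n v ∈ lowWeight N (w - n) := by
  have key : ∀ r n w : ℕ, ∀ v ∈ lowWeight N w,
      (PowerSeries.coeff n ((PowerSeries.mk (fun m : ℕ => if m = 0 then 0 else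
        ∑ x : Boson N, f (.mode x (m : ℤ)) • osc N ℓ k x (m : ℤ))) ^ r)) v
        ∈ lowWeight N (w - n) := by
    intro r
    induction r with
    | zero =>
      intro n w v hv
      rw [pow_zero, PowerSeries.coeff_one]
      split_ifs with h
      · subst h; simpa using hv
      · simp
    | succ r ih =>
      intro n w v hv
      rw [pow_succ, PowerSeries.coeff_mul, LinearMap.sum_apply]
      refine Submodule.sum_mem _ (fun ij hij => ?_)
      rw [Module.End.mul_apply]
      have hsum : ij.1 + ij.2 = n := Finset.HasAntidiagonal.mem_antidiagonal.1 hij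
      have h2 : w - n = (w - ij.2) - ij.1 := by omega
      rw [h2]
      apply ih
      rw [PowerSeries.coeff_mk]
      split_ifs with h
      · simp
      · rw [LinearMap.sum_apply]
        refine Submodule.sum_mem _ (fun x _ => ?_)
        rw [LinearMap.smul_apply]
        exact Submodule.smul_mem _ _ (osc_lowWeight N ℓ k x _ w h v hv)
  intro v hv
  unfold annihilation expCoeff
  rw [LinearMap.sum_apply]
  refine Submodule.sum_mem _ (fun r _ => ?_)
  rw [LinearMap.smul_apply]
  exact Submodule.smul_mem _ _ (key r n w v hv)

theorem exists_lowWeight (N : ℕ) (v : Osc N) : ∃ w, v ∈ lowWeight N w := by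
  have mono : ∀ w w' : ℕ, w ≤ w' → lowWeight N w ≤ lowWeight N w' := by
    intro w w' h
    refine Submodule.span_mono ?_
    rintro _ ⟨s, hs, rfl⟩
    exact ⟨s, by omega, rfl⟩
  induction v using MvPolynomial.induction_on' with
  | monomial s c =>
    refine ⟨wt s + 1, ?_⟩
    have h1 : MvPolynomial.monomial s c = c • (MvPolynomial.monomial s (1 : ℂ) : Osc N) := by
      rw [MvPolynomial.smul_monomial, smul_eq_mul, mul_one]
    rw [h1]
    exact Submodule.smul_mem _ _ (Submodule.subset_span ⟨s, Nat.lt_succ_self _, rfl⟩)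
  | add p p' hp hp' =>
    obtain ⟨w, hw⟩ := hp
    obtain ⟨w', hw'⟩ := hp'
    exact ⟨max w w', Submodule.add_mem _ (mono _ _ (le_max_left _ _) hw)
      (mono _ _ (le_max_right _ _) hw')⟩

theorem annihilation_finite (N : ℕ) (ℓ k : ℂ) (f : LinField N) (v : Osc N) :
    {d : ℕ | annihilation N ℓ k f d v ≠ 0}.Finite := by
  obtain ⟨w, hw⟩ := exists_lowWeight N v
  refine (Set.finite_lt_nat w).subset (fun d hd => ?_)
  by_contra hlt
  have hle : w ≤ d := not_lt.1 hlt
  have h := annihilation_lowWeight N ℓ k f d w v hw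
  rw [Nat.sub_eq_zero_of_le hle] at h
  have h0 : lowWeight N 0 = ⊥ := by
    unfold lowWeight
    rw [Submodule.span_eq_bot]
    rintro _ ⟨s, hs, rfl⟩
    omega
  rw [h0, Submodule.mem_bot] at h
  exact hd h

/-- The coefficient of `z ^ n` in the product of `creation` and `annihilation` series
(creation operators on the left); the sum over `d` is finite on every vector. -/
def oscVertex (N : ℕ) (ℓ k : ℂ) (f : LinField N) (n : ℤ) : Module.End ℂ (Osc N) where
  toFun v := ∑ᶠ d : ℕ, if 0 ≤ n + d then
    creation N ℓ k f (n + d).toNat (annihilation N ℓ k f d v) else 0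
  map_add' v v' := by
    have hfin : ∀ u : Osc N, (Function.support (fun d : ℕ => if 0 ≤ n + d then
        creation N ℓ k f (n + d).toNat (annihilation N ℓ k f d u) else 0)).Finite := by
      intro u
      refine (annihilation_finite N ℓ k f u).subset (fun d hd h0 => hd ?_)
      simp [h0]
    rw [← finsum_add_distrib (hfin v) (hfin v')]
    refine finsum_congr (fun d => ?_)
    split_ifs <;> simp
  map_smul' c v := by
    have hfin : (Function.support (fun d : ℕ => if 0 ≤ n + d then
        creation N ℓ k f (n + d).toNat (annihilation N ℓ k f d v) else 0)).Finite := by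
      refine (annihilation_finite N ℓ k f v).subset (fun d hd h0 => hd ?_)
      simp [h0]
    rw [RingHom.id_apply, smul_finsum' c hfin]
    refine finsum_congr (fun d => ?_)
    split_ifs <;> simp

/-- Formal series in `z`, with complex exponents, of operators on the Fock space:
`S e` is the coefficient of `z ^ e`. -/
abbrev Series (N : ℕ) : Type := ℂ → Module.End ℂ (Fock N)

/-- Multiplication of a series by `z ^ r`. -/
def zMul {N : ℕ} (r : ℂ) (S : Series N) : Series N := fun e => S (e - r)

/-- The change of momentum made by `exp (∑ α_y Q_y)`: the eigenvalue of `x_0` changes by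
`∑ α_y [x_0, Q_y]`. -/
def shift (N : ℕ) (k : ℂ) (α : Boson N → ℂ) : Momentum N :=
  fun x => ∑ y : Boson N, α y * zeroComm N k x y

/-- The value of `α` at `b^{i,N+1}`. -/
def odd {N : ℕ} (α : Boson N → ℂ) (i : ℕ) : ℂ :=
  if h : (i, N + 1) ∈ (Finset.Icc 1 (N + 1) ×ˢ Finset.Icc 1 (N + 1)).filter
      (fun p : ℕ × ℕ => p.1 < p.2) then α (.inr (.inl ⟨(i, N + 1), h⟩)) else 0

/-- The scalar `[∑ α_y Q_y, ∑ β_y Q_y]`, where `[Q_b^{i,N+1}, Q_b^{j,N+1}] = π √-1` for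
`1 ≤ i < j ≤ N` and the other commutators, up to antisymmetry, vanish. -/
def cocycle {N : ℕ} (α β : Boson N → ℂ) : ℂ :=
  (Real.pi : ℂ) * Complex.I * ∑ i ∈ Finset.Icc 1 N, ∑ j ∈ Finset.Icc 1 N,
    if i < j then odd α i * odd β j - odd α j * odd β i else 0

/-- The normally ordered exponential `:exp f(z):`, with `Q_x` and the modes `x_m`, `m < 0`, to the
left of the modes `x_m`, `m ≥ 0`. On `F(p)` the zero modes give the factor
`z ^ (∑ f(x_0 log z) p_x) exp (∑ f(x_0) p_x)`. Then `exp (∑ f(Q_x) Q_x)` maps `|p⟩`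
to `|p + shift⟩`; the vector `|p⟩` contains the factor
`exp (∑ p_b^{i,N+1} Q_b^{i,N+1})`, and `exp A exp B = exp ([A, B] / 2) exp (A + B)` for a scalar
commutator. -/
def normalExp (N : ℕ) (ℓ k : ℂ) (f : LinField N) : Series N := fun e =>
  Finsupp.lsum ℂ (fun p : Momentum N =>
    let E : ℂ := ∑ x : Boson N, f (.zlog x) * p x
    let n : ℤ := ⌊(e - E).re⌋
    if e = E + n then
      (Complex.exp (∑ x : Boson N, f (.mode x 0) * p x) *
          Complex.exp (cocycle (fun x => f (.Q x)) p / 2)) •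
        (Finsupp.lsingle (p + shift N k (fun x => f (.Q x))) ∘ₗ oscVertex N ℓ k f n)
    else 0)

/-! ### The bosonic fields, with the convention that a boson whose index is out of range is zero -/

/-- `a_+^i(q ^ s z)`. -/
def aP (N : ℕ) (ℓ : ℂ) (i : ℕ) (s : ℂ) : LinField N :=
  if h : i ∈ Finset.Icc 1 N then rescale ℓ s (plusPart N ℓ (.inl ⟨i, h⟩)) else 0

/-- `a_-^i(q ^ s z)`. -/
def aM (N : ℕ) (ℓ : ℂ) (i : ℕ) (s : ℂ) : LinField N :=
  if h : i ∈ Finset.Icc 1 N then rescale ℓ s (minusPart N ℓ (.inl ⟨i, h⟩)) else 0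

/-- `b^{i,j}(q ^ s z)`. -/
def b (N : ℕ) (ℓ : ℂ) (i j : ℕ) (s : ℂ) : LinField N :=
  if h : (i, j) ∈ (Finset.Icc 1 (N + 1) ×ˢ Finset.Icc 1 (N + 1)).filter
      (fun p : ℕ × ℕ => p.1 < p.2) then rescale ℓ s (full N ℓ (.inr (.inl ⟨(i, j), h⟩))) else 0

/-- `b_+^{i,j}(q ^ s z)`. -/
def bP (N : ℕ) (ℓ : ℂ) (i j : ℕ) (s : ℂ) : LinField N :=
  if h : (i, j) ∈ (Finset.Icc 1 (N + 1) ×ˢ Finset.Icc 1 (N + 1)).filter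
      (fun p : ℕ × ℕ => p.1 < p.2) then rescale ℓ s (plusPart N ℓ (.inr (.inl ⟨(i, j), h⟩)))
  else 0

/-- `b_-^{i,j}(q ^ s z)`. -/
def bM (N : ℕ) (ℓ : ℂ) (i j : ℕ) (s : ℂ) : LinField N :=
  if h : (i, j) ∈ (Finset.Icc 1 (N + 1) ×ˢ Finset.Icc 1 (N + 1)).filter
      (fun p : ℕ × ℕ => p.1 < p.2) then rescale ℓ s (minusPart N ℓ (.inr (.inl ⟨(i, j), h⟩)))
  else 0

/-- `c^{i,j}(q ^ s z)`. -/
def c (N : ℕ) (ℓ : ℂ) (i j : ℕ) (s : ℂ) : LinField N :=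
  if h : (i, j) ∈ (Finset.Icc 1 (N + 1) ×ˢ Finset.Icc 1 (N + 1)).filter
      (fun p : ℕ × ℕ => p.1 < p.2) then rescale ℓ s (full N ℓ (.inr (.inr ⟨(i, j), h⟩))) else 0

/-- `(b + c)^{i,j}(q ^ s z)`. -/
def bc (N : ℕ) (ℓ : ℂ) (i j : ℕ) (s : ℂ) : LinField N := b N ℓ i j s + c N ℓ i j s

/-- The operator `a_m^i`. -/
def aMode (N : ℕ) (ℓ k : ℂ) (i : ℕ) (m : ℤ) : Module.End ℂ (Fock N) :=
  if h : i ∈ Finset.Icc 1 N then mode N ℓ k (.inl ⟨i, h⟩) m else 0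

/-- The operator `b_m^{i,j}`. -/
def bMode (N : ℕ) (ℓ k : ℂ) (i j : ℕ) (m : ℤ) : Module.End ℂ (Fock N) :=
  if h : (i, j) ∈ (Finset.Icc 1 (N + 1) ×ˢ Finset.Icc 1 (N + 1)).filter
      (fun p : ℕ × ℕ => p.1 < p.2) then mode N ℓ k (.inr (.inl ⟨(i, j), h⟩)) m else 0

/-! ### The bosonization of the Drinfeld generators -/

/-- The operator `h_{i,m}`, `1 ≤ i ≤ N`. -/
def h (N : ℕ) (ℓ k : ℂ) (i : ℕ) (m : ℤ) : Module.End ℂ (Fock N) :=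
  if i = N then
    qPow ℓ (-((N - 1 : ℂ) / 2) * |m|) • aMode N ℓ k N m
      - ∑ l ∈ Finset.Icc 1 (N - 1),
          (qPow ℓ (-(k / 2 + l) * |m|) • bMode N ℓ k l N m
            + qPow ℓ (-(k / 2 + l) * |m|) • bMode N ℓ k l (N + 1) m)
  else
    qPow ℓ (-((N - 1 : ℂ) / 2) * |m|) • aMode N ℓ k i m
      + ∑ l ∈ Finset.Icc 1 i,
          (qPow ℓ (-(k / 2 + l - 1) * |m|) • bMode N ℓ k l (i + 1) m
            - qPow ℓ (-(k / 2 + l) * |m|) • bMode N ℓ k l i m)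
      + ∑ l ∈ Finset.Icc (i + 1) N,
          (qPow ℓ (-(k / 2 + l) * |m|) • bMode N ℓ k i l m
            - qPow ℓ (-(k / 2 + l - 1) * |m|) • bMode N ℓ k (i + 1) l m)
      + qPow ℓ (-(k / 2 + N) * |m|) • bMode N ℓ k i (N + 1) m
      - qPow ℓ (-(k / 2 + N - 1) * |m|) • bMode N ℓ k (i + 1) (N + 1) m

/-- The exponent of `X_i^{+(j,1)}(z)`, `1 ≤ j ≤ i ≤ N - 1`. -/
def xPlus1 (N : ℕ) (ℓ : ℂ) (i j : ℕ) : LinField N :=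
  bc N ℓ j i (j - 1) + bP N ℓ j (i + 1) (j - 1) - bc N ℓ j (i + 1) j
    + ∑ l ∈ Finset.Icc 1 (j - 1), (bP N ℓ l (i + 1) (l - 1) - bP N ℓ l i l)

/-- The exponent of `X_i^{+(j,2)}(z)`, `1 ≤ j ≤ i ≤ N - 1`. -/
def xPlus2 (N : ℕ) (ℓ : ℂ) (i j : ℕ) : LinField N :=
  bc N ℓ j i (j - 1) + bM N ℓ j (i + 1) (j - 1) - bc N ℓ j (i + 1) (j - 2)
    + ∑ l ∈ Finset.Icc 1 (j - 1), (bP N ℓ l (i + 1) (l - 1) - bP N ℓ l i l)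

/-- The exponent of `X_N^{+(j,0)}(z)`, `1 ≤ j ≤ N`. -/
def xPlusN (N : ℕ) (ℓ : ℂ) (j : ℕ) : LinField N :=
  bc N ℓ j N (j - 1) + b N ℓ j (N + 1) (j - 1)
    - ∑ l ∈ Finset.Icc 1 (j - 1), (bP N ℓ l (N + 1) l + bP N ℓ l N l)

/-- The current `X_i^+(z)`, `1 ≤ i ≤ N`. -/
def xPlus (N : ℕ) (ℓ k : ℂ) (i : ℕ) : Series N :=
  if i = N then
    qPow ℓ (N - 2) • ∑ j ∈ Finset.Icc 1 N, normalExp N ℓ k (xPlusN N ℓ j)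
  else
    (qPow ℓ 1 - qPow ℓ (-1))⁻¹ • zMul (-1) (∑ j ∈ Finset.Icc 1 i,
      (normalExp N ℓ k (xPlus1 N ℓ i j) - normalExp N ℓ k (xPlus2 N ℓ i j)))

/-- `∑_{l=r}^N (b_-^{i,l}(q^{-k-l}z) - b_-^{i+1,l}(q^{-k-l+1}z))
  + b_-^{i,N+1}(q^{-k-N}z) - b_-^{i+1,N+1}(q^{-k-N+1}z)`. -/
def tailM (N : ℕ) (ℓ k : ℂ) (i r : ℕ) : LinField N :=
  ∑ l ∈ Finset.Icc r N, (bM N ℓ i l (-k - l) - bM N ℓ (i + 1) l (-k - l + 1))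
    + bM N ℓ i (N + 1) (-k - N) - bM N ℓ (i + 1) (N + 1) (-k - N + 1)

/-- `∑_{l=r}^N (b_+^{i,l}(q^{k+l}z) - b_+^{i+1,l}(q^{k+l-1}z))
  + b_+^{i,N+1}(q^{k+N}z) - b_+^{i+1,N+1}(q^{k+N-1}z)`. -/
def tailP (N : ℕ) (ℓ k : ℂ) (i r : ℕ) : LinField N :=
  ∑ l ∈ Finset.Icc r N, (bP N ℓ i l (k + l) - bP N ℓ (i + 1) l (k + l - 1))
    + bP N ℓ i (N + 1) (k + N) - bP N ℓ (i + 1) (N + 1) (k + N - 1)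

/-- The exponent of `X_i^{-(j,1)}(z)`, `1 ≤ i ≤ N - 1`, `1 ≤ j ≤ N - 1`. -/
def xMinus1 (N : ℕ) (ℓ k : ℂ) (i j : ℕ) : LinField N :=
  if j < i then
    aM N ℓ i (-((k + N - 1) / 2)) + bc N ℓ j (i + 1) (-k - j) - bM N ℓ j i (-k - j)
      - bc N ℓ j i (-k - j + 1)
      + ∑ l ∈ Finset.Icc (j + 1) i, (bM N ℓ l (i + 1) (-k - l + 1) - bM N ℓ l i (-k - l))
      + tailM N ℓ k i (i + 1)
  else if j = i then
    aM N ℓ i (-((k + N - 1) / 2)) + bc N ℓ i (i + 1) (-k - i) + tailM N ℓ k i (i + 1)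
  else
    aP N ℓ i ((k + N - 1) / 2) + bc N ℓ i (j + 1) (k + j) + bP N ℓ (i + 1) (j + 1) (k + j)
      - bc N ℓ (i + 1) (j + 1) (k + j + 1) + tailP N ℓ k i (j + 1)

/-- The exponent of `X_i^{-(j,2)}(z)`, `1 ≤ i ≤ N - 1`, `1 ≤ j ≤ N - 1`. -/
def xMinus2 (N : ℕ) (ℓ k : ℂ) (i j : ℕ) : LinField N :=
  if j < i then
    aM N ℓ i (-((k + N - 1) / 2)) + bc N ℓ j (i + 1) (-k - j) - bP N ℓ j i (-k - j)
      - bc N ℓ j i (-k - j - 1)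
      + ∑ l ∈ Finset.Icc (j + 1) i, (bM N ℓ l (i + 1) (-k - l + 1) - bM N ℓ l i (-k - l))
      + tailM N ℓ k i (i + 1)
  else if j = i then
    aP N ℓ i ((k + N - 1) / 2) + bc N ℓ i (i + 1) (k + i) + tailP N ℓ k i (i + 1)
  else
    aP N ℓ i ((k + N - 1) / 2) + bc N ℓ i (j + 1) (k + j) + bM N ℓ (i + 1) (j + 1) (k + j)
      - bc N ℓ (i + 1) (j + 1) (k + j - 1) + tailP N ℓ k i (j + 1)

/-- The exponent of `X_i^{-(N,0)}(z)`, `1 ≤ i ≤ N - 1`. -/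
def xMinus0 (N : ℕ) (ℓ k : ℂ) (i : ℕ) : LinField N :=
  aP N ℓ i ((k + N - 1) / 2) - b N ℓ i (N + 1) (k + N - 1)
    - bP N ℓ (i + 1) (N + 1) (k + N - 1) + b N ℓ (i + 1) (N + 1) (k + N)

/-- The exponent of `X_N^{-(j,1)}(z)`, `1 ≤ j ≤ N`. -/
def xMinusN1 (N : ℕ) (ℓ k : ℂ) (j : ℕ) : LinField N :=
  if j = N then aM N ℓ N (-((k + N - 1) / 2)) - b N ℓ N (N + 1) (-k - N + 1)
  else
    aM N ℓ N (-((k + N - 1) / 2)) - bM N ℓ j N (-k - j) - bc N ℓ j N (-k - j + 1)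
      - bM N ℓ j (N + 1) (-k - j) - b N ℓ j (N + 1) (-k - j + 1)
      - ∑ l ∈ Finset.Icc (j + 1) (N - 1), (bM N ℓ l N (-k - l) + bM N ℓ l (N + 1) (-k - l))

/-- The exponent of `X_N^{-(j,2)}(z)`, `1 ≤ j ≤ N`. -/
def xMinusN2 (N : ℕ) (ℓ k : ℂ) (j : ℕ) : LinField N :=
  if j = N then aP N ℓ N ((k + N - 1) / 2) - b N ℓ N (N + 1) (k + N - 1)
  else
    aM N ℓ N (-((k + N - 1) / 2)) - bP N ℓ j N (-k - j) - bc N ℓ j N (-k - j - 1)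
      - bP N ℓ j (N + 1) (-k - j) - b N ℓ j (N + 1) (-k - j - 1)
      - ∑ l ∈ Finset.Icc (j + 1) (N - 1), (bM N ℓ l N (-k - l) + bM N ℓ l (N + 1) (-k - l))

/-- The current `X_i^-(z)`, `1 ≤ i ≤ N`. -/
def xMinus (N : ℕ) (ℓ k : ℂ) (i : ℕ) : Series N :=
  if i = N then
    (qPow ℓ 1 - qPow ℓ (-1))⁻¹ • zMul (-1) (∑ j ∈ Finset.Icc 1 N, qPow ℓ (-N + j + 1) •
      (-normalExp N ℓ k (xMinusN1 N ℓ k j) + normalExp N ℓ k (xMinusN2 N ℓ k j)))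
  else
    (qPow ℓ 1 - qPow ℓ (-1))⁻¹ • zMul (-1)
      (∑ j ∈ Finset.Icc 1 (i - 1),
          (normalExp N ℓ k (xMinus1 N ℓ k i j) - normalExp N ℓ k (xMinus2 N ℓ k i j))
        + (normalExp N ℓ k (xMinus1 N ℓ k i i) - normalExp N ℓ k (xMinus2 N ℓ k i i))
        - ∑ j ∈ Finset.Icc (i + 1) (N - 1),
          (normalExp N ℓ k (xMinus1 N ℓ k i j) - normalExp N ℓ k (xMinus2 N ℓ k i j)))
      + qPow ℓ (k + N - 1) • normalExp N ℓ k (xMinus0 N ℓ k i)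

/-! ### The elementary vertex operator -/

/-- The elementary vertex operator `φ^{l}(z | β)`: the normally ordered exponential of
`∑_{i,j} (l^i / (k+N-1) · Min(i,j) / (N-1) · (N-1-Max(i,j)) / 1 · a^j)(z | β)`. -/
def vertexOp (N : ℕ) (ℓ k : ℂ) (l : Idx N → ℂ) (β : ℂ) : Series N :=
  normalExp N ℓ k (∑ i : Idx N, ∑ j : Idx N,
    ratioField N ℓ [l i, ((min i.1 j.1 : ℕ) : ℂ), (N : ℂ) - 1 - ((max i.1 j.1 : ℕ) : ℂ)]
      [k + N - 1, (N : ℂ) - 1, 1] (.inl j) β)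

/-! ### Formal series in two variables -/

/-- `S e₁ e₂` is the coefficient of `z₁ ^ e₁ z₂ ^ e₂`. -/
abbrev Series₂ (N : ℕ) : Type := ℂ → ℂ → Module.End ℂ (Fock N)

/-- The product `S(z₁) T(z₂)`. -/
def prod₁₂ {N : ℕ} (S T : Series N) : Series₂ N := fun e₁ e₂ => S e₁ * T e₂

/-- The product `T(z₂) S(z₁)`. -/
def prod₂₁ {N : ℕ} (T S : Series N) : Series₂ N := fun e₁ e₂ => T e₂ * S e₁

/-- Multiplication by `z₁`. -/
def z₁Mul {N : ℕ} (F : Series₂ N) : Series₂ N := fun e₁ e₂ => F (e₁ - 1) e₂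

/-- Multiplication by `z₂`. -/
def z₂Mul {N : ℕ} (F : Series₂ N) : Series₂ N := fun e₁ e₂ => F e₁ (e₂ - 1)

end

end SuperFock

/-! The coefficients in the exponent of `vertexOp` invert the q-deformed Cartan matrix of sl(N|1).
For w(x) = [xm], the product w(min(i,j)) w(N-1-max(i,j)) is a discrete Green's function for the
tridiagonal matrix w(A_{i,j}); the limiting choice w(x) = x handles the zero modes
(`cartan_inverse`). Hence [a^i_m, φ(z|β)] = ([l^i m]/m) q^{-β|m|} z^m φ(z|β) and [a^i_0, φ] = l^i φ,
while φ contains no boson b or c and commutes with all of these (`vertexField_oscComm_inl`,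
`charge_vertexField_inl`).

The first relation follows because h_{i,m} is q^{-(N-1)|m|/2} a^i_m plus a combination of modes b.
The second follows because the exponents of X^+ contain no boson a, and φ contains no Q_b, so that
no cocycle sign arises.

For the third, every summand of X_i^- contains the bosons a only through a_+^i(q^s z) or
a_-^i(q^{-s} z), with s = (k+N-1)/2. Put t = q^{l^i}. At β = -s the powers of q^s cancel, and the
contraction of a_+^i(q^s z_1) with φ(z_2) is exp ∑_{m>0} (t^m - t^{-m}) x^m / m = (1 - t⁻¹x)/(1 -
tx), where x = z_2/z_1; the zero mode contributes a further factor t, and the product in the other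
order has trivial contraction. For a_- the contraction is found in the other order, with x = z_1/z_2
and zero-mode factor t⁻¹. Clearing denominators gives the same relation in both cases, and this
relation is linear in the current (`exchanges_of_aP`, `exchanges_of_aM`, `xMinus_exchanges`).

The analytic-looking step is carried out on coefficients. The exponential is controlled by its
logarithmic derivative (`expCoeff_mul`, `expCoeff_exchange`), and the infinite sums in a vertex
operator are cut off on each vector at a common finite index set (`oscVertex_eventually`). -/

namespace SuperFock

/-! ### Exponential series with coefficients in a noncommutative algebra. -/

section ExpCoeff

variable {R : Type*} [Ring R]

/-- The series `∑_{m ≥ 1} u_m w ^ m`. -/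
noncomputable def expBase (u : ℕ → R) : PowerSeries R :=
  PowerSeries.mk (fun m => if m = 0 then 0 else u m)

theorem coeff_expBase_pow (u : ℕ → R) {n r : ℕ} (h : n < r) :
    PowerSeries.coeff n (expBase u ^ r) = 0 := by
  induction r generalizing n with
  | zero => omega
  | succ r ih =>
    rw [pow_succ, PowerSeries.coeff_mul]
    refine Finset.sum_eq_zero fun ij hij => ?_
    have hij := Finset.HasAntidiagonal.mem_antidiagonal.1 hij
    rcases Nat.eq_zero_or_pos ij.2 with h0 | h0
    · simp [expBase, h0]
    · rw [ih (by omega), zero_mul]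

variable [Algebra ℂ R]

/-- The base has no constant term, so powers beyond the n-th do not reach degree n. A common bound
`M` then serves several degrees at once. -/
theorem expCoeff_eq_sum (u : ℕ → R) {n M : ℕ} (h : n < M) :
    expCoeff u n = ∑ r ∈ Finset.range M, ((r.factorial : ℂ)⁻¹) •
      PowerSeries.coeff n (expBase u ^ r) := by
  refine Finset.sum_subset (Finset.range_mono h) fun r _ hr => ?_
  rw [Finset.mem_range] at hr
  change _ • PowerSeries.coeff n (expBase u ^ r) = 0
  rw [coeff_expBase_pow u (by omega), smul_zero]

theorem expCoeff_zero (u : ℕ → R) : expCoeff u 0 = 1 := by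
  simp [expCoeff]

theorem inv_factorial_succ_mul (r : ℕ) :
    (((r + 1).factorial : ℂ)⁻¹) * (r + 1 : ℕ) = ((r.factorial : ℂ)⁻¹) := by
  have h1 : ((r + 1 : ℕ) : ℂ) ≠ 0 := Nat.cast_ne_zero.2 r.succ_ne_zero
  rw [Nat.factorial_succ, Nat.cast_mul, mul_inv, mul_comm, ← mul_assoc, mul_inv_cancel₀ h1, one_mul]

/-- The commutator with `x` is a derivation whose value on the base, κ w^M, is central; this is the
power rule for it. `hM` is needed because the base drops the entry `u 0`. -/
theorem lie_expBase_pow (x : R) (u : ℕ → R) (M : ℕ) (hM : M ≠ 0) (κ : ℂ)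
    (hx : ∀ m, m ≠ 0 → x * u m - u m * x = if m = M then algebraMap ℂ R κ else 0) (r : ℕ) :
    PowerSeries.C x * expBase u ^ (r + 1) - expBase u ^ (r + 1) * PowerSeries.C x =
      ((r + 1 : ℕ) : ℂ) • κ • (PowerSeries.X ^ M * expBase u ^ r) := by
  have h1 : PowerSeries.C x * expBase u = expBase u * PowerSeries.C x
      + κ • (PowerSeries.X ^ M : PowerSeries R) := by
    rw [← sub_eq_iff_eq_add']
    ext m
    rw [map_sub, PowerSeries.coeff_C_mul, PowerSeries.coeff_mul_C, PowerSeries.coeff_smul,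
      PowerSeries.coeff_X_pow, expBase, PowerSeries.coeff_mk]
    rcases eq_or_ne m 0 with rfl | hm
    · simp [hM.symm]
    · simp only [hm, if_false, hx m hm]
      split_ifs <;> simp [Algebra.algebraMap_eq_smul_one]
  induction r with
  | zero => simp [h1]
  | succ r ih =>
    rw [sub_eq_iff_eq_add'] at ih ⊢
    have hX : expBase u ^ (r + 1) * PowerSeries.X ^ M = PowerSeries.X ^ M * expBase u ^ (r + 1) :=
      ((PowerSeries.commute_X _).pow_right M).eq
    rw [pow_succ (expBase u) (r + 1), ← mul_assoc, ih, add_mul, mul_assoc (expBase u ^ (r + 1)), h1,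
      mul_add, mul_smul_comm, hX, smul_mul_assoc, smul_mul_assoc, mul_assoc (PowerSeries.X ^ M),
      ← pow_succ, ← mul_assoc, add_assoc, ← pow_succ]
    congr 1
    push_cast
    module

/-- If `[x, u_m] = κ δ_{m,M}`, then `[x, exp u] = κ w ^ M exp u`. -/
theorem lie_expCoeff (x : R) (u : ℕ → R) (M : ℕ) (hM : M ≠ 0) (κ : ℂ)
    (hx : ∀ m, m ≠ 0 → x * u m - u m * x = if m = M then algebraMap ℂ R κ else 0) (n : ℕ) :
    x * expCoeff u n - expCoeff u n * x = if M ≤ n then κ • expCoeff u (n - M) else 0 := by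
  have h1 : x * expCoeff u n - expCoeff u n * x = ∑ r ∈ Finset.range (n + 1),
      ((r.factorial : ℂ)⁻¹) • PowerSeries.coeff n (PowerSeries.C x * expBase u ^ r
        - expBase u ^ r * PowerSeries.C x) := by
    rw [expCoeff_eq_sum u (Nat.lt_succ_self n), Finset.mul_sum, Finset.sum_mul,
      ← Finset.sum_sub_distrib]
    refine Finset.sum_congr rfl fun r _ => ?_
    rw [map_sub, PowerSeries.coeff_C_mul, PowerSeries.coeff_mul_C, smul_sub, mul_smul_comm,
      smul_mul_assoc]
  rw [h1, Finset.sum_range_succ', pow_zero, mul_one, one_mul, sub_self, map_zero, smul_zero, add_zero]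
  have h2 : ∀ r, (((r + 1).factorial : ℂ)⁻¹) • PowerSeries.coeff n
      (PowerSeries.C x * expBase u ^ (r + 1) - expBase u ^ (r + 1) * PowerSeries.C x) =
      κ • ((r.factorial : ℂ)⁻¹) • (if M ≤ n then PowerSeries.coeff (n - M) (expBase u ^ r) else 0) := by
    intro r
    rw [lie_expBase_pow x u M hM κ hx, PowerSeries.coeff_smul, smul_smul, inv_factorial_succ_mul,
      PowerSeries.coeff_smul, PowerSeries.coeff_X_pow_mul', smul_comm]
  rw [Finset.sum_congr rfl fun r _ => h2 r]
  split_ifs with h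
  · rw [← Finset.smul_sum, ← expCoeff_eq_sum u (by omega)]
  · simp

theorem commute_expCoeff (x : R) (u : ℕ → R) (hx : ∀ m, m ≠ 0 → Commute x (u m)) (n : ℕ) :
    Commute x (expCoeff u n) := by
  have h1 := lie_expCoeff x u 1 one_ne_zero 0
    (fun m hm => by rw [(hx m hm).eq, sub_self, map_zero, ite_self]) n
  rw [zero_smul, ite_self] at h1
  exact sub_eq_zero.1 h1

/-- The derivation `w d/dw`. -/
noncomputable def euler (S : PowerSeries R) : PowerSeries R :=
  PowerSeries.mk fun n => (n : ℂ) • PowerSeries.coeff n S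

theorem euler_mul (S T : PowerSeries R) : euler (S * T) = euler S * T + S * euler T := by
  ext n
  simp only [euler, map_add, PowerSeries.coeff_mk, PowerSeries.coeff_mul, Finset.smul_sum,
    ← Finset.sum_add_distrib]
  refine Finset.sum_congr rfl fun ij hij => ?_
  rw [← Finset.HasAntidiagonal.mem_antidiagonal.1 hij, smul_mul_assoc, mul_smul_comm, ← add_smul, Nat.cast_add]

/-- The power rule for w d/dw; it requires the base to commute with its own derivative, which is the
role of `hu`. -/
theorem euler_expBase_pow (u : ℕ → R) (hu : ∀ m n, Commute (u m) (u n)) (r : ℕ) :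
    euler (expBase u ^ (r + 1)) = ((r + 1 : ℕ) : ℂ) • (euler (expBase u) * expBase u ^ r) := by
  have hc : expBase u * euler (expBase u) = euler (expBase u) * expBase u := by
    ext n
    rw [PowerSeries.coeff_mul, PowerSeries.coeff_mul, ← Finset.Nat.sum_antidiagonal_swap]
    refine Finset.sum_congr rfl fun ij _ => ?_
    simp only [euler, expBase, PowerSeries.coeff_mk, Prod.fst_swap, Prod.snd_swap]
    split_ifs <;> simp [(hu ij.2 ij.1).eq]
  induction r with
  | zero => simp
  | succ r ih =>
    rw [pow_succ' (expBase u) (r + 1), euler_mul, ih, mul_smul_comm, ← mul_assoc, hc, mul_assoc,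
      ← pow_succ']
    push_cast
    module

/-- This is w d/dw exp(u) = (w u') exp(u) read off at w^n: a recursion that determines the
coefficients of the exponential. -/
theorem smul_expCoeff (u : ℕ → R) (hu : ∀ m n, Commute (u m) (u n)) (n : ℕ) :
    (n : ℂ) • expCoeff u n =
      ∑ mj ∈ Finset.HasAntidiagonal.antidiagonal n, (mj.1 : ℂ) • (u mj.1 * expCoeff u mj.2) := by
  have h1 : ∀ r, (n : ℂ) • (((r + 1).factorial : ℂ)⁻¹) • PowerSeries.coeff n (expBase u ^ (r + 1)) =
      ((r.factorial : ℂ)⁻¹) • PowerSeries.coeff n (euler (expBase u) * expBase u ^ r) := by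
    intro r
    have h2 := congrArg (PowerSeries.coeff n) (euler_expBase_pow u hu r)
    rw [euler, PowerSeries.coeff_mk, PowerSeries.coeff_smul] at h2
    rw [smul_comm, h2, smul_smul, inv_factorial_succ_mul]
  have h0 : (n : ℂ) • ((Nat.factorial 0 : ℂ)⁻¹) • PowerSeries.coeff n (expBase u ^ 0) = 0 := by
    rw [pow_zero, PowerSeries.coeff_one]
    split_ifs with h <;> simp [h]
  rw [expCoeff_eq_sum u (Nat.lt_succ_self n), Finset.sum_range_succ', smul_add, h0, add_zero,
    Finset.smul_sum, Finset.sum_congr rfl fun r _ => h1 r]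
  simp only [PowerSeries.coeff_mul, Finset.smul_sum]
  rw [Finset.sum_comm]
  refine Finset.sum_congr rfl fun mj hmj => ?_
  have hmj := Finset.HasAntidiagonal.mem_antidiagonal.1 hmj
  rcases Nat.eq_zero_or_pos mj.1 with hm | hm
  · simp [hm, euler]
  · rw [expCoeff_eq_sum u (show mj.2 < n by omega), Finset.mul_sum, Finset.smul_sum]
    refine Finset.sum_congr rfl fun r _ => ?_
    rw [euler, PowerSeries.coeff_mk, expBase, PowerSeries.coeff_mk, if_neg hm.ne', mul_smul_comm,
      smul_mul_assoc, smul_comm]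

/-- If `[u_m, C(z)] = κ_m z ^ m C(z)`, then `exp (u(w)) C(z) = c(w z) C(z) exp (u(w))`, where
`c = exp (∑ κ_m x ^ m)` is given by its logarithmic derivative. -/
theorem expCoeff_mul (u : ℕ → R) (hu : ∀ m n, Commute (u m) (u n)) (C : ℤ → R) (κ c : ℕ → ℂ)
    (hC : ∀ m : ℕ, m ≠ 0 → ∀ n, u m * C n = C n * u m + κ m • C (n - m)) (hc0 : c 0 = 1)
    (hc : ∀ j : ℕ, j * c j = ∑ mi ∈ Finset.HasAntidiagonal.antidiagonal j, mi.1 * κ mi.1 * c mi.2) (d : ℕ) (n : ℤ) :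
    expCoeff u d * C n =
      ∑ ji ∈ Finset.HasAntidiagonal.antidiagonal d, c ji.1 • (C (n - ji.1) * expCoeff u ji.2) := by
  induction d using Nat.strong_induction_on generalizing n with
  | _ d ih =>
  rcases Nat.eq_zero_or_pos d with rfl | hd
  · simp [hc0, expCoeff_zero]
  have hd0 : (d : ℂ) ≠ 0 := Nat.cast_ne_zero.2 hd.ne'
  refine smul_right_injective R hd0 ?_
  change (d : ℂ) • _ = (d : ℂ) • _
  -- After expanding d times the d-th coefficient by the recursion, the induction hypothesis moves
  -- `C` past the shorter exponential coefficient. Moving `u_m` past `C` then splits each term into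
  -- one that keeps `u_m` and one with the contraction κ_m.
  have step : ∀ mj ∈ Finset.HasAntidiagonal.antidiagonal d, (mj.1 : ℂ) • (u mj.1 * expCoeff u mj.2) * C n =
      ∑ ji ∈ Finset.HasAntidiagonal.antidiagonal mj.2,
        ((c ji.1 * mj.1) • (C (n - ji.1) * (u mj.1 * expCoeff u ji.2))
          + (mj.1 * κ mj.1 * c ji.1) • (C (n - (mj.1 + ji.1 : ℕ)) * expCoeff u ji.2)) := by
    intro mj hmj
    have hmj := Finset.HasAntidiagonal.mem_antidiagonal.1 hmj
    rcases Nat.eq_zero_or_pos mj.1 with hm | hm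
    · simp [hm]
    rw [smul_mul_assoc, mul_assoc, ih mj.2 (by omega), Finset.mul_sum, Finset.smul_sum]
    refine Finset.sum_congr rfl fun ji _ => ?_
    rw [mul_smul_comm, ← mul_assoc, hC _ hm.ne', add_mul, mul_assoc, smul_mul_assoc]
    have e1 : n - (ji.1 : ℤ) - (mj.1 : ℤ) = n - ((mj.1 + ji.1 : ℕ) : ℤ) := by push_cast; ring
    rw [e1]
    module
  rw [← smul_mul_assoc, smul_expCoeff u hu, Finset.sum_mul, Finset.sum_congr rfl step]
  simp only [Finset.sum_add_distrib]
  -- In the terms that keep `u_m`, summing over m first reassembles the recursion for the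
  -- exponential, with weight `ji.2`.
  have h1 : ∑ mj ∈ Finset.HasAntidiagonal.antidiagonal d, ∑ ji ∈ Finset.HasAntidiagonal.antidiagonal mj.2,
      ((c ji.1 * mj.1) • (C (n - ji.1) * (u mj.1 * expCoeff u ji.2))) =
      ∑ ji ∈ Finset.HasAntidiagonal.antidiagonal d, (ji.2 * c ji.1) • (C (n - ji.1) * expCoeff u ji.2) := by
    have e : ∀ ji ∈ Finset.HasAntidiagonal.antidiagonal d, ((ji.2 : ℂ) * c ji.1) • (C (n - ji.1) * expCoeff u ji.2)
        = ∑ mi ∈ Finset.HasAntidiagonal.antidiagonal ji.2,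
          ((c ji.1 * mi.1) • (C (n - ji.1) * (u mi.1 * expCoeff u mi.2))) := by
      intro ji _
      rw [mul_comm, mul_smul, ← mul_smul_comm, smul_expCoeff u hu, Finset.mul_sum, Finset.smul_sum]
      refine Finset.sum_congr rfl fun mi _ => ?_
      rw [mul_smul_comm, smul_smul]
    rw [Finset.sum_congr rfl e]
    rw [Finset.sum_sigma', Finset.sum_sigma']
    refine Finset.sum_bij' (fun x _ => ⟨(x.2.1, x.1.1 + x.2.2), (x.1.1, x.2.2)⟩)
      (fun x _ => ⟨(x.2.1, x.1.1 + x.2.2), (x.1.1, x.2.2)⟩) ?_ ?_ ?_ ?_ ?_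
    · rintro ⟨⟨p, p'⟩, r, s⟩ hx
      simp only [Finset.mem_sigma, Finset.HasAntidiagonal.mem_antidiagonal] at hx ⊢
      exact ⟨by omega, trivial⟩
    · rintro ⟨⟨p, p'⟩, r, s⟩ hx
      simp only [Finset.mem_sigma, Finset.HasAntidiagonal.mem_antidiagonal] at hx ⊢
      exact ⟨by omega, trivial⟩
    · rintro ⟨⟨p, p'⟩, r, s⟩ hx
      simp only [Finset.mem_sigma, Finset.HasAntidiagonal.mem_antidiagonal] at hx
      simp [hx.2]
    · rintro ⟨⟨p, p'⟩, r, s⟩ hx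
      simp only [Finset.mem_sigma, Finset.HasAntidiagonal.mem_antidiagonal] at hx
      simp [hx.2]
    · intros; rfl
  -- The contraction terms reassemble the recursion `hc` for `c`, with weight `ji.1`. The two
  -- weights add up to d.
  have h2 : ∑ mj ∈ Finset.HasAntidiagonal.antidiagonal d, ∑ ji ∈ Finset.HasAntidiagonal.antidiagonal mj.2,
      ((mj.1 * κ mj.1 * c ji.1) • (C (n - (mj.1 + ji.1 : ℕ)) * expCoeff u ji.2)) =
      ∑ ji ∈ Finset.HasAntidiagonal.antidiagonal d, (ji.1 * c ji.1) • (C (n - ji.1) * expCoeff u ji.2) := by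
    have e : ∀ ji ∈ Finset.HasAntidiagonal.antidiagonal d, ((ji.1 : ℂ) * c ji.1) • (C (n - ji.1) * expCoeff u ji.2)
        = ∑ mi ∈ Finset.HasAntidiagonal.antidiagonal ji.1,
          ((mi.1 * κ mi.1 * c mi.2) • (C (n - (mi.1 + mi.2 : ℕ)) * expCoeff u ji.2)) := by
      intro ji _
      rw [hc, Finset.sum_smul]
      refine Finset.sum_congr rfl fun mi hmi => ?_
      rw [Finset.HasAntidiagonal.mem_antidiagonal.1 hmi]
    rw [Finset.sum_congr rfl e]
    rw [Finset.sum_sigma', Finset.sum_sigma']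
    refine Finset.sum_bij' (fun x _ => ⟨(x.1.1 + x.2.1, x.2.2), (x.1.1, x.2.1)⟩)
      (fun x _ => ⟨(x.2.1, x.2.2 + x.1.2), (x.2.2, x.1.2)⟩) ?_ ?_ ?_ ?_ ?_
    · rintro ⟨⟨p, p'⟩, r, s⟩ hx
      simp only [Finset.mem_sigma, Finset.HasAntidiagonal.mem_antidiagonal] at hx ⊢
      exact ⟨by omega, trivial⟩
    · rintro ⟨⟨p, p'⟩, r, s⟩ hx
      simp only [Finset.mem_sigma, Finset.HasAntidiagonal.mem_antidiagonal] at hx ⊢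
      exact ⟨by omega, trivial⟩
    · rintro ⟨⟨p, p'⟩, r, s⟩ hx
      simp only [Finset.mem_sigma, Finset.HasAntidiagonal.mem_antidiagonal] at hx
      simp [hx.2]
    · rintro ⟨⟨p, p'⟩, r, s⟩ hx
      simp only [Finset.mem_sigma, Finset.HasAntidiagonal.mem_antidiagonal] at hx
      simp [hx.2]
    · intros; rfl
  rw [h1, h2, ← Finset.sum_add_distrib, Finset.smul_sum]
  refine Finset.sum_congr rfl fun ji hji => ?_
  rw [← Finset.HasAntidiagonal.mem_antidiagonal.1 hji]
  push_cast
  module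

end ExpCoeff

/-! ### Integer-indexed coefficients and the contraction (1 - t⁻¹x)/(1 - tx). -/

section Extend

variable {R : Type*} [Ring R]

/-- The extension by zero of a sequence to negative indices. -/
def zExt (u : ℕ → R) (n : ℤ) : R := if 0 ≤ n then u n.toNat else 0

theorem zExt_natCast (u : ℕ → R) (n : ℕ) : zExt u n = u n := by
  simp [zExt]

theorem zExt_of_neg (u : ℕ → R) {n : ℤ} (hn : n < 0) : zExt u n = 0 :=
  if_neg (not_le.2 hn)

theorem commute_zExt {x : R} {u : ℕ → R} (hx : ∀ n, Commute x (u n)) (n : ℤ) :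
    Commute x (zExt u n) := by
  unfold zExt
  split_ifs
  · exact hx _
  · exact Commute.zero_right x

variable [Algebra ℂ R]

theorem lie_zExt_expCoeff (x : R) (u : ℕ → R) (M : ℕ) (hM : M ≠ 0) (κ : ℂ)
    (hx : ∀ m, m ≠ 0 → x * u m - u m * x = if m = M then algebraMap ℂ R κ else 0) (n : ℤ) :
    x * zExt (expCoeff u) n - zExt (expCoeff u) n * x = κ • zExt (expCoeff u) (n - M) := by
  rcases lt_or_ge n 0 with hn | hn
  · rw [zExt_of_neg _ hn, zExt_of_neg _ (by omega)]
    simp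
  · lift n to ℕ using hn
    rw [zExt_natCast, lie_expCoeff x u M hM κ hx]
    split_ifs with h
    · rw [← Nat.cast_sub h, zExt_natCast]
    · rw [zExt_of_neg _ (by omega), smul_zero]

/-- The coefficients of `(1 - t⁻¹ x) / (1 - t x)`. -/
noncomputable def ratioCoeff (t : ℂ) : ℕ → ℂ
  | 0 => 1
  | j + 1 => (t - t⁻¹) * t ^ j

/-- The geometric part of the sum has denominator t - t⁻¹. Keeping that factor on the left avoids
excluding t = ±1. -/
theorem sum_antidiagonal_pow (t : ℂ) (n : ℕ) :
    (t - t⁻¹) * ∑ mi ∈ Finset.HasAntidiagonal.antidiagonal n,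
      (t ^ mi.1 - t⁻¹ ^ mi.1) * t ^ mi.2 =
      (n + 1) * ((t - t⁻¹) * t ^ n) - (t ^ (n + 1) - t⁻¹ ^ (n + 1)) := by
  induction n with
  | zero => simp
  | succ n ih =>
    have h1 : ∀ mi ∈ Finset.HasAntidiagonal.antidiagonal n, (t ^ mi.1 - t⁻¹ ^ mi.1) * t ^ (mi.2 + 1) =
        t * ((t ^ mi.1 - t⁻¹ ^ mi.1) * t ^ mi.2) := fun _ _ => by ring
    rw [Finset.Nat.sum_antidiagonal_succ', Finset.sum_congr rfl h1, ← Finset.mul_sum, mul_add,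
      mul_left_comm _ t, ih]
    push_cast
    ring

/-- The logarithmic derivative x d/dx of (1 - t⁻¹x)/(1 - tx) is ∑ (t^m - t^{-m}) x^m, so its
coefficients satisfy the recursion required by `expCoeff_mul`. -/
theorem ratioCoeff_rec (t : ℂ) (j : ℕ) :
    j * ratioCoeff t j = ∑ mi ∈ Finset.HasAntidiagonal.antidiagonal j,
      mi.1 * ((t ^ mi.1 - t⁻¹ ^ mi.1) / mi.1) * ratioCoeff t mi.2 := by
  have h0 : ∀ m : ℕ, (m : ℂ) * ((t ^ m - t⁻¹ ^ m) / m) = t ^ m - t⁻¹ ^ m := by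
    intro m
    rcases Nat.eq_zero_or_pos m with rfl | hm
    · simp
    · rw [mul_div_cancel₀]
      exact Nat.cast_ne_zero.2 hm.ne'
  simp only [h0]
  cases j with
  | zero => simp [ratioCoeff]
  | succ n =>
    have h1 : ∀ mi ∈ Finset.HasAntidiagonal.antidiagonal n,
        (t ^ mi.1 - t⁻¹ ^ mi.1) * ratioCoeff t (mi.2 + 1) =
        (t - t⁻¹) * ((t ^ mi.1 - t⁻¹ ^ mi.1) * t ^ mi.2) := fun _ _ => by
      rw [ratioCoeff]; ring
    rw [Finset.Nat.sum_antidiagonal_succ', Finset.sum_congr rfl h1, ← Finset.mul_sum,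
      sum_antidiagonal_pow t, ratioCoeff, ratioCoeff]
    push_cast
    ring

/-- If `[u_m, C(z)] = (t ^ m - t ^ (-m)) / m z ^ m C(z)`, then
`(1 - t w z) exp (u(w)) C(z) = (1 - t⁻¹ w z) C(z) exp (u(w))`. -/
theorem expCoeff_exchange (u : ℕ → R) (hu : ∀ m n, Commute (u m) (u n)) (C : ℤ → R) (t : ℂ)
    (hC : ∀ m : ℕ, m ≠ 0 → ∀ n, u m * C n - C n * u m = ((t ^ m - t⁻¹ ^ m) / m) • C (n - m))
    (d n : ℤ) :
    zExt (expCoeff u) d * C n - t • (zExt (expCoeff u) (d - 1) * C (n - 1)) =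
      C n * zExt (expCoeff u) d - t⁻¹ • (C (n - 1) * zExt (expCoeff u) (d - 1)) := by
  have key := expCoeff_mul u hu C (fun m => (t ^ m - t⁻¹ ^ m) / m) (ratioCoeff t)
    (fun m hm n => sub_eq_iff_eq_add'.1 (hC m hm n)) rfl (ratioCoeff_rec t)
  rcases lt_or_ge d 0 with hd | hd
  · rw [zExt_of_neg _ hd, zExt_of_neg _ (by omega)]
    simp
  lift d to ℕ using hd
  cases d with
  | zero =>
    rw [zExt_of_neg (n := ((0 : ℕ) : ℤ) - 1) _ (by norm_num), zExt_natCast, expCoeff_zero]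
    simp
  | succ d =>
    have e : ((d + 1 : ℕ) : ℤ) - 1 = (d : ℕ) := by push_cast; ring
    rw [e, zExt_natCast, zExt_natCast, key, key, Finset.Nat.sum_antidiagonal_succ, Finset.smul_sum,
      add_sub_assoc, ← Finset.sum_sub_distrib]
    simp only [show ratioCoeff t 0 = 1 from rfl,
      show ∀ j, ratioCoeff t (j + 1) = (t - t⁻¹) * t ^ j from fun _ => rfl, one_smul,
      Nat.cast_zero, sub_zero]
    rw [sub_eq_add_neg (C n * _)]
    congr 1
    -- Multiplication by 1 - tx clears the denominator: `ratioCoeff` is geometric with ratio t from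
    -- index 1 on, so all terms cancel except the first, where (t - t⁻¹) - t = -t⁻¹.
    have h1 : ∀ x : ℕ × ℕ, ((t - t⁻¹) * t ^ x.1) • (C (n - (x.1 + 1 : ℕ)) * expCoeff u x.2) -
        t • ratioCoeff t x.1 • (C (n - 1 - x.1) * expCoeff u x.2) =
        if x.1 = 0 then - (t⁻¹ • (C (n - 1) * expCoeff u x.2)) else 0 := by
      rintro ⟨a, b⟩
      have e2 : n - ((a + 1 : ℕ) : ℤ) = n - 1 - a := by push_cast; ring
      simp only [e2]
      cases a with
      | zero =>
        simp only [ratioCoeff, Nat.cast_zero, sub_zero, if_true, pow_zero]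
        module
      | succ a =>
        simp only [ratioCoeff, Nat.succ_ne_zero, if_false]
        rw [smul_smul, ← sub_smul]
        convert zero_smul ℂ _
        ring
    rw [Finset.sum_congr rfl fun x _ => h1 x, Finset.sum_eq_single (0, d)]
    · simp
    · rintro ⟨a, b⟩ hx hne
      rw [if_neg]
      rintro rfl
      exact hne (by simpa using hx)
    · simp

theorem lie_sum_smul {ι : Type*} [Fintype ι] (x : R) (c : ι → ℂ) (u : ι → R) (κ : ι → ℂ)
    {p : Prop} [Decidable p]
    (h : ∀ i, x * u i - u i * x = if p then algebraMap ℂ R (κ i) else 0) :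
    x * ∑ i, c i • u i - (∑ i, c i • u i) * x =
      if p then algebraMap ℂ R (∑ i, c i * κ i) else 0 := by
  simp only [Finset.mul_sum, Finset.sum_mul, mul_smul_comm, smul_mul_assoc]
  rw [← Finset.sum_sub_distrib]
  simp only [← smul_sub, h]
  split_ifs
  · simp only [map_sum, Algebra.algebraMap_eq_smul_one, smul_smul]
  · simp

theorem sum_smul_lie {ι : Type*} [Fintype ι] (x : R) (c : ι → ℂ) (u : ι → R) (κ : ι → ℂ)
    {p : Prop} [Decidable p]
    (h : ∀ i, u i * x - x * u i = if p then algebraMap ℂ R (κ i) else 0) :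
    (∑ i, c i • u i) * x - x * ∑ i, c i • u i =
      if p then algebraMap ℂ R (∑ i, c i * κ i) else 0 := by
  have h1 := lie_sum_smul x c u (fun i => -κ i) (p := p) fun i => by
    rw [← neg_sub, h]
    split_ifs <;> simp
  rw [← neg_sub, h1]
  split_ifs <;> simp

end Extend

/-! ### Oscillators -/

section Oscillators

variable {N : ℕ} {ℓ k : ℂ}

theorem osc_neg (x : Boson N) {n : ℕ} (hn : n ≠ 0) : osc N ℓ k x (-(n : ℤ)) =
    LinearMap.mulLeft ℂ (MvPolynomial.X (x, n.toPNat')) := by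
  rw [osc, if_neg (by omega), if_pos (by omega), Int.natAbs_neg, Int.natAbs_natCast]

theorem osc_pos (x : Boson N) {n : ℕ} (hn : n ≠ 0) : osc N ℓ k x n =
    (MvPolynomial.mkDerivation ℂ (fun y : Boson N × ℕ+ =>
      if (y.2 : ℤ) = n then (MvPolynomial.C (oscComm N ℓ k x y.1 n) : Osc N)
        else 0)).toLinearMap := by
  rw [osc, if_pos (by omega)]

theorem osc_zero (x : Boson N) : osc N ℓ k x 0 = 0 := by
  simp [osc]

theorem commute_osc_neg (x y : Boson N) (m n : ℕ) :
    Commute (osc N ℓ k x (-(m : ℤ))) (osc N ℓ k y (-(n : ℤ))) := by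
  rcases eq_or_ne m 0 with rfl | hm
  · simp [osc_zero]
  rcases eq_or_ne n 0 with rfl | hn
  · simp [osc_zero]
  rw [osc_neg x hm, osc_neg y hn]
  exact LinearMap.ext fun v => mul_left_comm _ _ _

/-- The commutator of two derivations is a derivation, and it kills every variable because each of
the two sends variables to constants. -/
theorem commute_osc_pos (x y : Boson N) (m n : ℕ) :
    Commute (osc N ℓ k x m) (osc N ℓ k y n) := by
  rcases eq_or_ne m 0 with rfl | hm
  · simp [osc_zero]
  rcases eq_or_ne n 0 with rfl | hn
  · simp [osc_zero]
  rw [osc_pos x hm, osc_pos y hn]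
  refine sub_eq_zero.1 ?_
  set D₁ : Derivation ℂ (Osc N) (Osc N) := MvPolynomial.mkDerivation ℂ _
  set D₂ : Derivation ℂ (Osc N) (Osc N) := MvPolynomial.mkDerivation ℂ _
  have h : ⁅D₁, D₂⁆ = 0 := by
    refine MvPolynomial.derivation_ext fun i => ?_
    rw [Derivation.commutator_apply]
    simp only [D₁, D₂, MvPolynomial.mkDerivation_X]
    split_ifs <;> simp
  refine LinearMap.ext fun v => ?_
  have := congrArg (fun D : Derivation ℂ (Osc N) (Osc N) => D v) h
  simpa [Derivation.commutator_apply] using this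

theorem osc_pos_lie_neg (x y : Boson N) {m n : ℕ} (hm : m ≠ 0) (hn : n ≠ 0) :
    osc N ℓ k x m * osc N ℓ k y (-(n : ℤ)) - osc N ℓ k y (-(n : ℤ)) * osc N ℓ k x m =
      if n = m then algebraMap ℂ _ (oscComm N ℓ k x y m) else 0 := by
  rw [osc_pos x hm, osc_neg y hn]
  refine LinearMap.ext fun v => ?_
  have h1 : ((n.toPNat' : ℕ+) : ℕ) = n := by
    rw [Nat.toPNat'_coe, if_pos (by omega)]
  simp only [LinearMap.sub_apply, Module.End.mul_apply, LinearMap.mulLeft_apply,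
    Derivation.coeFn_coe, Derivation.leibniz, MvPolynomial.mkDerivation_X, h1, smul_eq_mul,
    add_sub_cancel_left]
  by_cases h : n = m
  · simp [h, Module.algebraMap_end_apply, MvPolynomial.smul_eq_C_mul, mul_comm]
  · simp [h]

/-- The part `f_m` of `f` in the modes of degree `m`. -/
noncomputable def degPart (ℓ k : ℂ) (f : LinField N) (m : ℤ) : Module.End ℂ (Osc N) :=
  ∑ x : Boson N, f (.mode x m) • osc N ℓ k x m

/-- The scalar `[f_m, g_{-m}]`, `m > 0`. -/
noncomputable def pairing (ℓ k : ℂ) (f g : LinField N) (m : ℤ) : ℂ :=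
  ∑ x : Boson N, ∑ y : Boson N, f (.mode x m) * g (.mode y (-m)) * oscComm N ℓ k x y m

theorem commute_degPart_neg (f g : LinField N) (m n : ℕ) :
    Commute (degPart ℓ k f (-(m : ℤ))) (degPart ℓ k g (-(n : ℤ))) :=
  Commute.sum_left _ _ _ fun _ _ => Commute.sum_right _ _ _ fun _ _ =>
    ((commute_osc_neg _ _ m n).smul_left _).smul_right _

theorem commute_degPart_pos (f g : LinField N) (m n : ℕ) :
    Commute (degPart ℓ k f m) (degPart ℓ k g n) :=
  Commute.sum_left _ _ _ fun _ _ => Commute.sum_right _ _ _ fun _ _ =>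
    ((commute_osc_pos _ _ m n).smul_left _).smul_right _

theorem osc_pos_lie_degPart (x : Boson N) (g : LinField N) {m n : ℕ} (hm : m ≠ 0) (hn : n ≠ 0) :
    osc N ℓ k x m * degPart ℓ k g (-(n : ℤ)) - degPart ℓ k g (-(n : ℤ)) * osc N ℓ k x m =
      if n = m then algebraMap ℂ _ (∑ y, g (.mode y (-m)) * oscComm N ℓ k x y m) else 0 := by
  refine (lie_sum_smul _ _ _ _ fun y => osc_pos_lie_neg x y hm hn).trans ?_
  split_ifs with h
  · rw [h]
  · rfl

theorem osc_neg_lie_degPart (x : Boson N) (g : LinField N) {m n : ℕ} (hm : m ≠ 0) (hn : n ≠ 0) :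
    osc N ℓ k x (-(m : ℤ)) * degPart ℓ k g n - degPart ℓ k g n * osc N ℓ k x (-(m : ℤ)) =
      if n = m then algebraMap ℂ _ (-∑ y, g (.mode y m) * oscComm N ℓ k y x m) else 0 := by
  have h1 := sum_smul_lie (osc N ℓ k x (-(m : ℤ))) (fun y => g (.mode y n)) _ _
    fun y => osc_pos_lie_neg y x hn hm
  rw [← neg_sub]
  refine (congrArg Neg.neg h1).trans ?_
  rcases eq_or_ne n m with rfl | h
  · simp only [if_true, map_neg]
  · simp only [h, h.symm, if_false, neg_zero]

theorem degPart_lie_degPart (f g : LinField N) {m n : ℕ} (hm : m ≠ 0) (hn : n ≠ 0) :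
    degPart ℓ k f m * degPart ℓ k g (-(n : ℤ)) - degPart ℓ k g (-(n : ℤ)) * degPart ℓ k f m =
      if n = m then algebraMap ℂ _ (pairing ℓ k f g m) else 0 := by
  refine (sum_smul_lie _ _ _ _ fun x => osc_pos_lie_degPart x g hm hn).trans ?_
  simp only [pairing, Finset.mul_sum, mul_assoc]

/-- The coefficient of `z ^ n` in the creation part of `:exp f(z):`, `n ∈ ℤ`. -/
noncomputable def cre (ℓ k : ℂ) (f : LinField N) : ℤ → Module.End ℂ (Osc N) :=
  zExt (creation N ℓ k f)

/-- The coefficient of `z ^ (-n)` in the annihilation part of `:exp f(z):`, `n ∈ ℤ`. -/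
noncomputable def ann (ℓ k : ℂ) (f : LinField N) : ℤ → Module.End ℂ (Osc N) :=
  zExt (annihilation N ℓ k f)

theorem commute_cre_cre (f g : LinField N) (m n : ℤ) : Commute (cre ℓ k f m) (cre ℓ k g n) :=
  commute_zExt (fun _ => commute_expCoeff _ _ (fun _ _ =>
    (commute_zExt (fun _ => commute_expCoeff _ _ (fun _ _ =>
      commute_degPart_neg _ _ _ _) _) _).symm) _) _

theorem commute_ann_ann (f g : LinField N) (m n : ℤ) : Commute (ann ℓ k f m) (ann ℓ k g n) :=
  commute_zExt (fun _ => commute_expCoeff _ _ (fun _ _ =>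
    (commute_zExt (fun _ => commute_expCoeff _ _ (fun _ _ =>
      commute_degPart_pos _ _ _ _) _) _).symm) _) _

theorem commute_ann_cre (f g : LinField N) (h : ∀ m : ℕ, m ≠ 0 → pairing ℓ k f g m = 0) (m n : ℤ) :
    Commute (ann ℓ k f m) (cre ℓ k g n) := by
  have h1 : ∀ a b : ℕ, a ≠ 0 → b ≠ 0 →
      Commute (degPart ℓ k f b) (degPart ℓ k g (-(a : ℤ))) := fun a b ha hb =>
    sub_eq_zero.1 (by rw [degPart_lie_degPart f g hb ha, h b hb, map_zero, ite_self])
  have h2 : ∀ b : ℕ, b ≠ 0 → Commute (degPart ℓ k f b) (cre ℓ k g n) := fun b hb =>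
    commute_zExt (fun _ => commute_expCoeff _ _ (fun a ha => h1 a b ha hb) _) _
  exact (commute_zExt (fun _ => commute_expCoeff _ _ (fun b hb => (h2 b hb).symm) _) _).symm

/-- Scalar commutators of single modes first give [f_m, exp g] as a multiple of a shift of exp g, by
`lie_zExt_expCoeff`. This is the input that `expCoeff_exchange` needs to exponentiate the other
factor. -/
theorem ann_exchange_cre (f g : LinField N) (t : ℂ)
    (h : ∀ m : ℕ, m ≠ 0 → pairing ℓ k f g m = (t ^ m - t⁻¹ ^ m) / m) (d n : ℤ) :
    ann ℓ k f d * cre ℓ k g n - t • (ann ℓ k f (d - 1) * cre ℓ k g (n - 1)) =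
      cre ℓ k g n * ann ℓ k f d - t⁻¹ • (cre ℓ k g (n - 1) * ann ℓ k f (d - 1)) := by
  refine expCoeff_exchange _ (commute_degPart_pos f f) _ t (fun m hm n => ?_) d n
  refine lie_zExt_expCoeff _ _ m hm _ (fun a ha => ?_) n
  rw [← h m hm]
  exact degPart_lie_degPart f g hm ha

theorem osc_pos_lie_cre (x : Boson N) (g : LinField N) {m : ℕ} (hm : m ≠ 0) (n : ℤ) :
    osc N ℓ k x m * cre ℓ k g n - cre ℓ k g n * osc N ℓ k x m =
      (∑ y, g (.mode y (-m)) * oscComm N ℓ k x y m) • cre ℓ k g (n - m) :=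
  lie_zExt_expCoeff _ _ m hm _ (fun _ ha => osc_pos_lie_degPart x g hm ha) n

theorem osc_neg_lie_ann (x : Boson N) (g : LinField N) {m : ℕ} (hm : m ≠ 0) (n : ℤ) :
    osc N ℓ k x (-(m : ℤ)) * ann ℓ k g n - ann ℓ k g n * osc N ℓ k x (-(m : ℤ)) =
      (-∑ y, g (.mode y m) * oscComm N ℓ k y x m) • ann ℓ k g (n - m) :=
  lie_zExt_expCoeff _ _ m hm _ (fun _ ha => osc_neg_lie_degPart x g hm ha) n

theorem commute_osc_pos_ann (x : Boson N) (g : LinField N) (m : ℕ) (n : ℤ) :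
    Commute (osc N ℓ k x m) (ann ℓ k g n) :=
  commute_zExt (fun _ => commute_expCoeff _ _ (fun _ _ =>
    Commute.sum_right _ _ _ fun _ _ => (commute_osc_pos _ _ _ _).smul_right _) _) _

theorem commute_osc_neg_cre (x : Boson N) (g : LinField N) (m : ℕ) (n : ℤ) :
    Commute (osc N ℓ k x (-(m : ℤ))) (cre ℓ k g n) :=
  commute_zExt (fun _ => commute_expCoeff _ _ (fun _ _ =>
    Commute.sum_right _ _ _ fun _ _ => (commute_osc_neg _ _ _ _).smul_right _) _) _

/-! ### Vertex operators on a single Fock space -/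

theorem ann_finite (f : LinField N) (v : Osc N) : {d : ℤ | ann ℓ k f d v ≠ 0}.Finite := by
  refine ((annihilation_finite N ℓ k f v).image ((↑) : ℕ → ℤ)).subset fun d hd => ?_
  rcases lt_or_ge d 0 with h | h
  · exact absurd (by rw [ann, zExt_of_neg _ h, LinearMap.zero_apply]) hd
  · lift d to ℕ using h
    rw [Set.mem_ofPred_eq, ann, zExt_natCast] at hd
    exact ⟨d, hd, rfl⟩

/-- With both factors extended by zero, the guard `0 ≤ n + d` disappears and the sum over all
integers can be translated freely. -/
theorem oscVertex_apply (f : LinField N) (n : ℤ) (v : Osc N) :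
    oscVertex N ℓ k f n v = ∑ᶠ d : ℤ, cre ℓ k f (n + d) (ann ℓ k f d v) := by
  have h1 : (Function.support fun d => cre ℓ k f (n + d) (ann ℓ k f d v)) ⊆
      Set.range ((↑) : ℕ → ℤ) := by
    intro d hd
    rcases lt_or_ge d 0 with h | h
    · exact absurd (by simp only [ann, zExt_of_neg _ h, LinearMap.zero_apply, map_zero]) hd
    · exact ⟨d.toNat, Int.toNat_of_nonneg h⟩
  rw [← finsum_mem_univ, ← finsum_mem_inter_support, Set.univ_inter,
    ← Set.inter_eq_right.2 h1, finsum_mem_inter_support, finsum_mem_range Nat.cast_injective]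
  refine finsum_congr fun d => ?_
  rw [ann, zExt_natCast, cre, zExt]
  split_ifs <;> simp

/-- The sum that defines a vertex operator, cut off at a large finite set and shifted by `r`. -/
theorem oscVertex_eventually (f : LinField N) (n r : ℤ) (v : Osc N) :
    ∀ᶠ s : Finset ℤ in Filter.atTop, oscVertex N ℓ k f n v =
      ∑ d ∈ s, cre ℓ k f (n + (d - r)) (ann ℓ k f (d - r) v) := by
  have hfin : {d : ℤ | ann ℓ k f (d - r) v ≠ 0}.Finite :=
    (ann_finite f v).preimage (f := fun d : ℤ => d - r) sub_left_injective.injOn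
  filter_upwards [Filter.eventually_ge_atTop hfin.toFinset] with s hs
  rw [oscVertex_apply, ← finsum_comp_equiv (Equiv.subRight r)]
  refine finsum_eq_sum_of_support_subset _ fun d hd => hs (hfin.mem_toFinset.2 fun h => hd ?_)
  simp only [Equiv.subRight_apply, h, map_zero]

theorem commute_apply {S T : Module.End ℂ (Osc N)} (h : Commute S T) (v : Osc N) :
    S (T v) = T (S v) :=
  congrArg (fun A : Module.End ℂ (Osc N) => A v) h.eq

theorem commute_oscVertex {T : Module.End ℂ (Osc N)} {f : LinField N}
    (hc : ∀ n, Commute T (cre ℓ k f n)) (ha : ∀ n, Commute T (ann ℓ k f n)) (n : ℤ) :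
    Commute T (oscVertex N ℓ k f n) := by
  refine LinearMap.ext fun v => ?_
  -- Each expansion holds for all sufficiently large finite sets, so one set serves both. The claim
  -- becomes a termwise identity of finite sums; the lemmas below use the same device.
  obtain ⟨s, h1, h2⟩ := ((oscVertex_eventually (ℓ := ℓ) (k := k) f n 0 v).and
    (oscVertex_eventually f n 0 (T v))).exists
  rw [Module.End.mul_apply, Module.End.mul_apply, h1, h2, map_sum]
  exact Finset.sum_congr rfl fun d _ => by rw [commute_apply (hc _), commute_apply (ha _)]

theorem oscVertex_lie_of_cre {T : Module.End ℂ (Osc N)} {f : LinField N} {κ : ℂ} {m : ℤ}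
    (hc : ∀ n, T * cre ℓ k f n - cre ℓ k f n * T = κ • cre ℓ k f (n - m))
    (ha : ∀ n, Commute T (ann ℓ k f n)) (n : ℤ) :
    T * oscVertex N ℓ k f n - oscVertex N ℓ k f n * T = κ • oscVertex N ℓ k f (n - m) := by
  refine LinearMap.ext fun v => ?_
  obtain ⟨s, ⟨h1, h2⟩, h3⟩ := (((oscVertex_eventually (ℓ := ℓ) (k := k) f n 0 v).and
    (oscVertex_eventually f n 0 (T v))).and (oscVertex_eventually f (n - m) 0 v)).exists
  rw [LinearMap.sub_apply, LinearMap.smul_apply, Module.End.mul_apply, Module.End.mul_apply,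
    h1, h2, h3, map_sum, ← Finset.sum_sub_distrib, Finset.smul_sum]
  refine Finset.sum_congr rfl fun d _ => ?_
  have h4 := congrArg (fun S : Module.End ℂ (Osc N) => S (ann ℓ k f (d - 0) v)) (hc (n + (d - 0)))
  simp only [LinearMap.sub_apply, LinearMap.smul_apply, Module.End.mul_apply] at h4
  rw [← commute_apply (ha _), h4, sub_add_eq_add_sub]

theorem oscVertex_lie_of_ann {T : Module.End ℂ (Osc N)} {f : LinField N} {κ : ℂ} {m : ℤ}
    (hc : ∀ n, Commute T (cre ℓ k f n))
    (ha : ∀ n, T * ann ℓ k f n - ann ℓ k f n * T = κ • ann ℓ k f (n - m)) (n : ℤ) :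
    T * oscVertex N ℓ k f n - oscVertex N ℓ k f n * T = κ • oscVertex N ℓ k f (n + m) := by
  refine LinearMap.ext fun v => ?_
  -- The third sum is translated by `m`, so that all three share the creation factor of index `n +
  -- d`.
  obtain ⟨s, ⟨h1, h2⟩, h3⟩ := (((oscVertex_eventually (ℓ := ℓ) (k := k) f n 0 v).and
    (oscVertex_eventually f n 0 (T v))).and (oscVertex_eventually f (n + m) m v)).exists
  rw [LinearMap.sub_apply, LinearMap.smul_apply, Module.End.mul_apply, Module.End.mul_apply,
    h1, h2, h3, map_sum, ← Finset.sum_sub_distrib, Finset.smul_sum]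
  refine Finset.sum_congr rfl fun d _ => ?_
  have h4 := congrArg (fun S : Module.End ℂ (Osc N) => S v) (ha d)
  simp only [LinearMap.sub_apply, LinearMap.smul_apply, Module.End.mul_apply] at h4
  have e : n + m + (d - m) = n + d := by ring
  rw [commute_apply (hc _), ← map_sub, sub_zero, h4, map_smul, e]

/-- The creation part of `f` commutes with that of `g`, so the relation is `ann_exchange_cre`
multiplied on the left by the creation part of `f`. -/
theorem oscVertex_exchange_cre {f g : LinField N} {t : ℂ}
    (h : ∀ m : ℕ, m ≠ 0 → pairing ℓ k f g m = (t ^ m - t⁻¹ ^ m) / m) (n m : ℤ) :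
    oscVertex N ℓ k f (n - 1) * cre ℓ k g m - t • (oscVertex N ℓ k f n * cre ℓ k g (m - 1)) =
      cre ℓ k g m * oscVertex N ℓ k f (n - 1) - t⁻¹ • (cre ℓ k g (m - 1) * oscVertex N ℓ k f n) := by
  refine LinearMap.ext fun v => ?_
  obtain ⟨s, ⟨h1, h2⟩, h3, h4⟩ :=
    (((oscVertex_eventually (ℓ := ℓ) (k := k) f (n - 1) 0 (cre ℓ k g m v)).and
      (oscVertex_eventually f n 1 (cre ℓ k g (m - 1) v))).and
      ((oscVertex_eventually f (n - 1) 0 v).and (oscVertex_eventually f n 1 v))).exists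
  simp only [LinearMap.sub_apply, LinearMap.smul_apply, Module.End.mul_apply]
  rw [h1, h2, h3, h4, map_sum, map_sum, Finset.smul_sum, Finset.smul_sum,
    ← Finset.sum_sub_distrib, ← Finset.sum_sub_distrib]
  refine Finset.sum_congr rfl fun d _ => ?_
  have e : n - 1 + (d - 0) = n + (d - 1) := by ring
  have h5 := congrArg (fun S : Module.End ℂ (Osc N) => S v) (ann_exchange_cre f g t h d m)
  simp only [LinearMap.sub_apply, LinearMap.smul_apply, Module.End.mul_apply] at h5
  rw [e, sub_zero, commute_apply (commute_cre_cre g f _ _), commute_apply (commute_cre_cre g f _ _)]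
  simpa only [map_sub, map_smul] using congrArg (cre ℓ k f (n + (d - 1))) h5

/-- The exchange relation of two vertex operators one of whose contractions is
`(1 - t⁻¹ x) / (1 - t x)`, and whose other contraction is trivial. -/
theorem oscVertex_exchange {f g : LinField N} {t : ℂ}
    (h : ∀ m : ℕ, m ≠ 0 → pairing ℓ k f g m = (t ^ m - t⁻¹ ^ m) / m)
    (h' : ∀ m : ℕ, m ≠ 0 → pairing ℓ k g f m = 0) (n m : ℤ) :
    oscVertex N ℓ k f (n - 1) * oscVertex N ℓ k g m
        - t • (oscVertex N ℓ k f n * oscVertex N ℓ k g (m - 1)) =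
      oscVertex N ℓ k g m * oscVertex N ℓ k f (n - 1)
        - t⁻¹ • (oscVertex N ℓ k g (m - 1) * oscVertex N ℓ k f n) := by
  -- Since the opposite contraction is trivial, the annihilation part of `g` passes through the
  -- whole vertex operator of `f`; only the creation part of `g` remains to be exchanged.
  have hcomm : ∀ d a, Commute (ann ℓ k g d) (oscVertex N ℓ k f a) := fun d a =>
    commute_oscVertex (commute_ann_cre g f h' d) (commute_ann_ann g f d) a
  refine LinearMap.ext fun v => ?_
  obtain ⟨s, ⟨h1, h2⟩, h3, h4⟩ :=
    (((oscVertex_eventually (ℓ := ℓ) (k := k) g m 0 v).and (oscVertex_eventually g (m - 1) 0 v)).and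
      ((oscVertex_eventually g m 0 (oscVertex N ℓ k f (n - 1) v)).and
        (oscVertex_eventually g (m - 1) 0 (oscVertex N ℓ k f n v)))).exists
  simp only [LinearMap.sub_apply, LinearMap.smul_apply, Module.End.mul_apply]
  rw [h1, h2, h3, h4, map_sum, map_sum, Finset.smul_sum, Finset.smul_sum,
    ← Finset.sum_sub_distrib, ← Finset.sum_sub_distrib]
  refine Finset.sum_congr rfl fun d _ => ?_
  have h5 := congrArg (fun S : Module.End ℂ (Osc N) => S (ann ℓ k g d v))
    (oscVertex_exchange_cre h n (m + d))
  simp only [LinearMap.sub_apply, LinearMap.smul_apply, Module.End.mul_apply] at h5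
  rw [sub_zero, commute_apply (hcomm _ _), commute_apply (hcomm _ _), sub_add_eq_add_sub, h5]

theorem commute_oscVertex_oscVertex {f g : LinField N}
    (h : ∀ m : ℕ, m ≠ 0 → pairing ℓ k f g m = 0)
    (h' : ∀ m : ℕ, m ≠ 0 → pairing ℓ k g f m = 0) (n m : ℤ) :
    Commute (oscVertex N ℓ k f n) (oscVertex N ℓ k g m) :=
  commute_oscVertex
    (fun a => (commute_oscVertex (commute_cre_cre g f a)
      (fun b => (commute_ann_cre f g h b a).symm) n).symm)
    (fun a => (commute_oscVertex (commute_ann_cre g f h' a) (commute_ann_ann g f a) n).symm) m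

end Oscillators

/-! ### The exchange relation, stable under linear combinations and translations of the exponent. -/

section Exchange

variable {R : Type*} [Ring R] [Algebra ℂ R]

/-- The relation `(z₁ - t z₂) S(z₁) Φ(z₂) = (t z₁ - z₂) Φ(z₂) S(z₁)`. -/
def Exchanges (Φ : ℂ → R) (t : ℂ) (S : ℂ → R) : Prop :=
  ∀ e₁ e₂, S (e₁ - 1) * Φ e₂ - t • (S e₁ * Φ (e₂ - 1)) =
    t • (Φ e₂ * S (e₁ - 1)) - Φ (e₂ - 1) * S e₁

namespace Exchanges

variable {Φ S T : ℂ → R} {t : ℂ}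

theorem add (hS : Exchanges Φ t S) (hT : Exchanges Φ t T) : Exchanges Φ t (S + T) := by
  intro e₁ e₂
  simp only [Pi.add_apply, add_mul, mul_add, smul_add]
  rw [add_sub_add_comm, hS e₁ e₂, hT e₁ e₂, add_sub_add_comm]

theorem smul (hS : Exchanges Φ t S) (c : ℂ) : Exchanges Φ t (c • S) := by
  intro e₁ e₂
  simp only [Pi.smul_apply, smul_mul_assoc, mul_smul_comm]
  rw [smul_comm t c, smul_comm t c, ← smul_sub, hS e₁ e₂, smul_sub]

theorem neg (hS : Exchanges Φ t S) : Exchanges Φ t (-S) := by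
  have h1 := hS.smul (-1)
  rwa [neg_one_smul] at h1

theorem sub (hS : Exchanges Φ t S) (hT : Exchanges Φ t T) : Exchanges Φ t (S - T) := by
  rw [sub_eq_add_neg]
  exact hS.add hT.neg

theorem sum {ι : Type*} {s : Finset ι} {F : ι → ℂ → R} (h : ∀ j ∈ s, Exchanges Φ t (F j)) :
    Exchanges Φ t (∑ j ∈ s, F j) :=
  Finset.sum_induction F (Exchanges Φ t) (fun _ _ h₁ h₂ => h₁.add h₂) (fun e₁ e₂ => by simp) h

theorem translate (hS : Exchanges Φ t S) (r : ℂ) : Exchanges Φ t (fun e => S (e - r)) := by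
  intro e₁ e₂
  have h1 := hS (e₁ - r) e₂
  rw [sub_right_comm] at h1
  exact h1

end Exchanges

end Exchange

/-! ### Normally ordered exponentials on the full Fock space, with zero modes. -/

section Fock

variable {N : ℕ} {ℓ k : ℂ}

theorem qInt_neg (ℓ x : ℂ) : qInt ℓ (-x) = -qInt ℓ x := by
  rw [qInt, qInt, neg_neg, ← neg_div, neg_sub]

theorem cartan_comm (N i j : ℕ) : cartan N i j = cartan N j i := by
  unfold cartan
  split_ifs <;> first | rfl | omega

theorem oscComm_neg (x y : Boson N) (m : ℤ) :
    oscComm N ℓ k x y (-m) = -oscComm N ℓ k y x m := by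
  rcases x with i | p | p <;> rcases y with j | p' | p' <;>
    simp only [oscComm, neg_zero, Int.cast_neg, mul_neg, qInt_neg, neg_sq, div_neg, neg_neg, neg_mul]
  · rw [cartan_comm]
  all_goals
    rcases eq_or_ne p p' with rfl | h
    · simp
    · simp [h, h.symm]

/-- A mode with m > 0 sees only the creation part, one with m < 0 only the annihilation part.
Antisymmetry of `oscComm` puts the second case into the form of the first. -/
theorem osc_lie_oscVertex (x : Boson N) (g : LinField N) {m : ℤ} (hm : m ≠ 0) (n : ℤ) :
    osc N ℓ k x m * oscVertex N ℓ k g n - oscVertex N ℓ k g n * osc N ℓ k x m =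
      (∑ y, g (.mode y (-m)) * oscComm N ℓ k x y m) • oscVertex N ℓ k g (n - m) := by
  obtain ⟨M, rfl | rfl⟩ := m.eq_nat_or_neg
  · have hM : M ≠ 0 := by omega
    exact oscVertex_lie_of_cre (osc_pos_lie_cre x g hM) (commute_osc_pos_ann x g M) n
  · have hM : M ≠ 0 := by omega
    rw [oscVertex_lie_of_ann (commute_osc_neg_cre x g M) (osc_neg_lie_ann x g hM) n, sub_neg_eq_add,
      neg_neg, ← Finset.sum_neg_distrib]
    congr 1
    exact Finset.sum_congr rfl fun y _ => by rw [oscComm_neg, mul_neg]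

theorem mode_single (x : Boson N) {m : ℤ} (hm : m ≠ 0) (p : Momentum N) (v : Osc N) :
    mode N ℓ k x m (Finsupp.single p v) = Finsupp.single p (osc N ℓ k x m v) := by
  simp [mode, hm]

theorem mode_zero_single (x : Boson N) (p : Momentum N) (v : Osc N) :
    mode N ℓ k x 0 (Finsupp.single p v) = p x • Finsupp.single p v := by
  simp [mode]

/-- The exponent of `z` by which `x_0 log z` acts on `F(p)`. -/
noncomputable def zExponent (f : LinField N) (p : Momentum N) : ℂ :=
  ∑ x : Boson N, f (.zlog x) * p x

/-- The scalar in the action of `:exp f(z):` on `F(p)`. -/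
noncomputable def zeroFactor (f : LinField N) (p : Momentum N) : ℂ :=
  Complex.exp (∑ x : Boson N, f (.mode x 0) * p x) *
    Complex.exp (cocycle (fun x => f (.Q x)) p / 2)

/-- The change of momentum made by `:exp f(z):`. -/
noncomputable def charge (k : ℂ) (f : LinField N) : Momentum N := shift N k fun x => f (.Q x)

theorem normalExp_single (f : LinField N) (p : Momentum N) (v : Osc N) (n : ℤ) :
    normalExp N ℓ k f (zExponent f p + n) (Finsupp.single p v) =
      zeroFactor f p • Finsupp.single (p + charge k f) (oscVertex N ℓ k f n v) := by
  -- The integer that `normalExp` recovers through the floor of a real part is `n` itself.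
  have h1 : ⌊(zExponent f p + n - zExponent f p).re⌋ = n := by simp
  rw [normalExp, Finsupp.lsum_single]
  change (if zExponent f p + n = zExponent f p + (⌊(zExponent f p + n - zExponent f p).re⌋ : ℤ)
    then _ else _ : Osc N →ₗ[ℂ] Fock N) v = _
  rw [h1, if_pos rfl]
  change (_ : ℂ) • (Finsupp.single _ (oscVertex N ℓ k f ⌊(zExponent f p + n - zExponent f p).re⌋ v) : Fock N) = _
  rw [h1]
  rfl

theorem normalExp_single_of_ne (f : LinField N) (p : Momentum N) (v : Osc N) {e : ℂ}
    (he : ∀ n : ℤ, e ≠ zExponent f p + n) : normalExp N ℓ k f e (Finsupp.single p v) = 0 := by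
  rw [normalExp, Finsupp.lsum_single]
  change (if e = zExponent f p + (⌊(e - zExponent f p).re⌋ : ℤ)
    then _ else _ : Osc N →ₗ[ℂ] Fock N) v = _
  rw [if_neg (he _)]
  rfl

theorem end_ext {S T : Module.End ℂ (Fock N)}
    (h : ∀ p v, S (Finsupp.single p v) = T (Finsupp.single p v)) : S = T :=
  Finsupp.lhom_ext (φ := S) (ψ := T) h

theorem mode_lie_normalExp (x : Boson N) (g : LinField N) {m : ℤ} (hm : m ≠ 0) (e : ℂ) :
    mode N ℓ k x m * normalExp N ℓ k g e - normalExp N ℓ k g e * mode N ℓ k x m =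
      (∑ y, g (.mode y (-m)) * oscComm N ℓ k x y m) • normalExp N ℓ k g (e - m) := by
  refine end_ext fun p v => ?_
  simp only [LinearMap.sub_apply, LinearMap.smul_apply, Module.End.mul_apply, mode_single x hm p]
  by_cases he : ∃ n : ℤ, e = zExponent g p + n
  · obtain ⟨n, rfl⟩ := he
    have e1 : zExponent g p + n - m = zExponent g p + ((n - m : ℤ) : ℂ) := by push_cast; ring
    have h1 := congrArg (fun S : Module.End ℂ (Osc N) => S v)
      (osc_lie_oscVertex (ℓ := ℓ) (k := k) x g hm n)
    simp only [LinearMap.sub_apply, LinearMap.smul_apply, Module.End.mul_apply] at h1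
    rw [e1, normalExp_single, normalExp_single, normalExp_single, map_smul, mode_single x hm,
      ← smul_sub, ← Finsupp.single_sub, h1, smul_comm,
      ← Finsupp.smul_single]
  · have he' : ∀ n : ℤ, e ≠ zExponent g p + n := fun n h => he ⟨n, h⟩
    rw [normalExp_single_of_ne g p v he', normalExp_single_of_ne g p _ he',
      normalExp_single_of_ne g p v (e := e - m)]
    · simp
    · intro n h
      exact he' (n + m) (by push_cast; rw [← add_assoc, ← h]; ring)

theorem mode_zero_lie_normalExp (x : Boson N) (g : LinField N) (e : ℂ) :
    mode N ℓ k x 0 * normalExp N ℓ k g e - normalExp N ℓ k g e * mode N ℓ k x 0 =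
      charge k g x • normalExp N ℓ k g e := by
  refine end_ext fun p v => ?_
  simp only [LinearMap.sub_apply, LinearMap.smul_apply, Module.End.mul_apply, mode_zero_single x p]
  by_cases he : ∃ n : ℤ, e = zExponent g p + n
  · obtain ⟨n, rfl⟩ := he
    rw [map_smul, normalExp_single, map_smul, mode_zero_single, Pi.add_apply]
    module
  · have he' : ∀ n : ℤ, e ≠ zExponent g p + n := fun n h => he ⟨n, h⟩
    rw [map_smul, normalExp_single_of_ne g p v he']
    simp

/-- The zero modes of `:exp f:` and `:exp g:` commute up to the factor `μ` picked up by `:exp f:`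
behind `:exp g:`. -/
structure ZeroModeExchange (k : ℂ) (f g : LinField N) (μ : ℂ) : Prop where
  zExponent_left : ∀ p, zExponent f (p + charge k g) = zExponent f p
  zExponent_right : ∀ p, zExponent g (p + charge k f) = zExponent g p
  zeroFactor_left : ∀ p, zeroFactor f (p + charge k g) = μ * zeroFactor f p
  zeroFactor_right : ∀ p, zeroFactor g (p + charge k f) = zeroFactor g p

namespace ZeroModeExchange

variable {f g : LinField N} {μ : ℂ}

theorem mul_single (h : ZeroModeExchange k f g μ) (p : Momentum N) (v : Osc N) (n m : ℤ) :
    (normalExp N ℓ k f (zExponent f p + n) * normalExp N ℓ k g (zExponent g p + m))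
        (Finsupp.single p v) =
      (zeroFactor f p * zeroFactor g p) • Finsupp.single (p + charge k f + charge k g)
        ((μ • (oscVertex N ℓ k f n * oscVertex N ℓ k g m)) v) := by
  rw [Module.End.mul_apply, normalExp_single, map_smul, ← h.zExponent_left, normalExp_single,
    h.zeroFactor_left, add_right_comm, LinearMap.smul_apply, ← Finsupp.smul_single,
    Module.End.mul_apply]
  module

theorem mul_single' (h : ZeroModeExchange k f g μ) (p : Momentum N) (v : Osc N) (n m : ℤ) :
    (normalExp N ℓ k g (zExponent g p + m) * normalExp N ℓ k f (zExponent f p + n))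
        (Finsupp.single p v) =
      (zeroFactor f p * zeroFactor g p) • Finsupp.single (p + charge k f + charge k g)
        ((oscVertex N ℓ k g m * oscVertex N ℓ k f n) v) := by
  rw [Module.End.mul_apply, normalExp_single, map_smul, ← h.zExponent_right, normalExp_single,
    h.zeroFactor_right, Module.End.mul_apply]
  module

theorem mul_single_of_ne (h : ZeroModeExchange k f g μ) (p : Momentum N) (v : Osc N) {e₁ e₂ : ℂ}
    (he : (∀ n : ℤ, e₁ ≠ zExponent f p + n) ∨ ∀ m : ℤ, e₂ ≠ zExponent g p + m) :
    (normalExp N ℓ k f e₁ * normalExp N ℓ k g e₂) (Finsupp.single p v) = 0 := by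
  rw [Module.End.mul_apply]
  by_cases h2 : ∃ m : ℤ, e₂ = zExponent g p + m
  · obtain ⟨m, rfl⟩ := h2
    have h1 : ∀ n : ℤ, e₁ ≠ zExponent f p + n := he.resolve_right fun h3 => h3 m rfl
    rw [normalExp_single, map_smul, normalExp_single_of_ne, smul_zero]
    simpa only [h.zExponent_left] using h1
  · rw [normalExp_single_of_ne g p v fun m hm => h2 ⟨m, hm⟩, map_zero]

theorem mul_single_of_ne' (h : ZeroModeExchange k f g μ) (p : Momentum N) (v : Osc N) {e₁ e₂ : ℂ}
    (he : (∀ n : ℤ, e₁ ≠ zExponent f p + n) ∨ ∀ m : ℤ, e₂ ≠ zExponent g p + m) :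
    (normalExp N ℓ k g e₂ * normalExp N ℓ k f e₁) (Finsupp.single p v) = 0 := by
  rw [Module.End.mul_apply]
  by_cases h1 : ∃ n : ℤ, e₁ = zExponent f p + n
  · obtain ⟨n, rfl⟩ := h1
    have h2 : ∀ m : ℤ, e₂ ≠ zExponent g p + m := he.resolve_left fun h3 => h3 n rfl
    rw [normalExp_single, map_smul, normalExp_single_of_ne, smul_zero]
    simpa only [h.zExponent_right] using h2
  · rw [normalExp_single_of_ne f p v fun n hn => h1 ⟨n, hn⟩, map_zero]

end ZeroModeExchange

theorem sub_one_ne_add_int {e E : ℂ} (h : ∀ n : ℤ, e ≠ E + n) (n : ℤ) : e - 1 ≠ E + n := by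
  intro h1
  refine h (n + 1) ?_
  push_cast
  rw [← add_assoc, ← h1, sub_add_cancel]

theorem normalExp_commute {f g : LinField N} (h : ZeroModeExchange k f g 1)
    (hV : ∀ n m, Commute (oscVertex N ℓ k f n) (oscVertex N ℓ k g m)) (e₁ e₂ : ℂ) :
    Commute (normalExp N ℓ k f e₁) (normalExp N ℓ k g e₂) := by
  refine end_ext fun p v => ?_
  by_cases he : (∃ n : ℤ, e₁ = zExponent f p + n) ∧ ∃ m : ℤ, e₂ = zExponent g p + m
  · obtain ⟨⟨n, rfl⟩, m, rfl⟩ := he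
    rw [h.mul_single, h.mul_single', one_smul, (hV n m).eq]
  · rw [not_and_or, not_exists, not_exists] at he
    rw [h.mul_single_of_ne p v he, h.mul_single_of_ne' p v he]

/-- On one momentum sector the four products have the same target momentum and the same scalar apart
from μ, so the relation reduces to oscillators. If an exponent lies outside its coset of ℤ, so do
its unit shifts, and every term vanishes. -/
theorem normalExp_exchanges {f g : LinField N} {μ t : ℂ} (h : ZeroModeExchange k f g μ)
    (hV : ∀ n m : ℤ, μ • (oscVertex N ℓ k f (n - 1) * oscVertex N ℓ k g m)
        - t • μ • (oscVertex N ℓ k f n * oscVertex N ℓ k g (m - 1)) =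
      t • (oscVertex N ℓ k g m * oscVertex N ℓ k f (n - 1))
        - oscVertex N ℓ k g (m - 1) * oscVertex N ℓ k f n) :
    Exchanges (normalExp N ℓ k g) t (normalExp N ℓ k f) := by
  intro e₁ e₂
  refine end_ext fun p v => ?_
  simp only [LinearMap.sub_apply, LinearMap.smul_apply]
  by_cases he : (∃ n : ℤ, e₁ = zExponent f p + n) ∧ ∃ m : ℤ, e₂ = zExponent g p + m
  · obtain ⟨⟨n, rfl⟩, m, rfl⟩ := he
    have e1 : ∀ (E : ℂ) (n : ℤ), E + n - 1 = E + ((n - 1 : ℤ) : ℂ) := fun E n => by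
      push_cast; ring
    have h1 := congrArg (fun S : Module.End ℂ (Osc N) => S v) (hV n m)
    simp only [LinearMap.sub_apply, LinearMap.smul_apply] at h1
    rw [e1, e1, h.mul_single, h.mul_single, h.mul_single', h.mul_single', smul_comm t,
      smul_comm t, ← smul_sub, ← smul_sub, Finsupp.smul_single, Finsupp.smul_single,
      ← Finsupp.single_sub, ← Finsupp.single_sub, LinearMap.smul_apply, LinearMap.smul_apply, h1]
  · rw [not_and_or, not_exists, not_exists] at he
    have he₁ := he.imp_left sub_one_ne_add_int
    have he₂ := he.imp_right sub_one_ne_add_int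
    rw [h.mul_single_of_ne p v he₁, h.mul_single_of_ne p v he₂, h.mul_single_of_ne' p v he₁,
      h.mul_single_of_ne' p v he₂, smul_zero]

end Fock

/-! ### The inverse of the q-deformed Cartan matrix, and q-number identities. -/

section CartanInverse

/-- A row of the Cartan matrix is tridiagonal. The condition G 0 = 0 supplies the missing left
neighbour of row 1, and row N has zero diagonal. -/
theorem sum_cartan_mul (N : ℕ) (w : ℂ → ℂ) (h0 : w 0 = 0) (G : ℕ → ℂ) (hG : G 0 = 0)
    (hN : 2 ≤ N) {i : ℕ} (hi : i ∈ Finset.Icc 1 N) :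
    ∑ j ∈ Finset.Icc 1 N, w (cartan N i j) * G j =
      if i = N then w (-1) * G (N - 1) else w 2 * G i + w (-1) * G (i - 1) + w (-1) * G (i + 1) := by
  have hi' := Finset.mem_Icc.1 hi
  split_ifs with hiN
  · subst hiN
    rw [Finset.sum_eq_single (i - 1)]
    · rw [cartan, if_neg (by omega), if_pos (by omega)]
      norm_num
    · intro j hj hne
      rw [Finset.mem_Icc] at hj
      have hc : cartan i i j = 0 := by
        unfold cartan
        split_ifs <;> first | rfl | omega
      rw [hc, Int.cast_zero, h0, zero_mul]
    · intro h
      exact absurd (Finset.mem_Icc.2 ⟨by omega, by omega⟩) h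
  · have h1 : ∀ j ∈ Finset.Icc 1 N, w (cartan N i j) * G j = (if j = i then w 2 * G i else 0)
        + (if j = i - 1 then w (-1) * G (i - 1) else 0)
        + if j = i + 1 then w (-1) * G (i + 1) else 0 := by
      intro j hj
      rw [Finset.mem_Icc] at hj
      rcases eq_or_ne j i with rfl | hne
      · simp [cartan, hiN, show j ≠ j - 1 by omega]
      by_cases h2 : j = i - 1
      · rw [cartan, if_neg hne.symm, if_pos (by omega), if_neg hne, if_pos h2, if_neg (by omega), h2]
        norm_num
      by_cases h3 : j = i + 1
      · rw [cartan, if_neg hne.symm, if_pos (by omega), if_neg hne, if_neg h2, if_pos h3, h3]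
        norm_num
      · rw [cartan, if_neg hne.symm, if_neg (by omega), if_neg hne, if_neg h2, if_neg h3,
          Int.cast_zero, h0]
        simp
    have h2 : (if i - 1 ∈ Finset.Icc 1 N then w (-1) * G (i - 1) else 0) = w (-1) * G (i - 1) := by
      rcases eq_or_ne i 1 with rfl | h1i
      · simp [hG]
      · rw [if_pos (Finset.mem_Icc.2 ⟨by omega, by omega⟩)]
    rw [Finset.sum_congr rfl h1, Finset.sum_add_distrib, Finset.sum_add_distrib, Finset.sum_ite_eq',
      Finset.sum_ite_eq', Finset.sum_ite_eq', if_pos hi, h2,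
      if_pos (Finset.mem_Icc.2 ⟨by omega, by omega⟩)]

/-- For fixed i', both branches j ↦ w(j) and j ↦ w(N-1-j) solve w(2)G(j) = w(1)(G(j+1) + G(j-1)), so
rows i < N with i ≠ i' give zero; the kink at i' contributes a Wronskian. In row N the only entry is
at N-1, where w(0) = 0 unless i' = N. The abstract w covers both [xm] and x. -/
theorem cartan_inverse (N : ℕ) (hN : 2 ≤ N) (w : ℂ → ℂ) (hodd : ∀ x, w (-x) = -w x)
    (hw : ∀ x y, w x * w y - w (x - 1) * w (y - 1) = w (x + y - 1) * w 1)
    {i i' : ℕ} (hi : i ∈ Finset.Icc 1 N) (hi' : i' ∈ Finset.Icc 1 N) :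
    ∑ j ∈ Finset.Icc 1 N, w (cartan N i j) * (w ((min i' j : ℕ) : ℂ) *
        w ((N : ℂ) - 1 - ((max i' j : ℕ) : ℂ))) =
      if i' = i then w ((N : ℂ) - 1) * w 1 * w 1 else 0 := by
  have h0 : w 0 = 0 := by
    have := hodd 0
    rw [neg_zero] at this
    linear_combination this / 2
  have h2 : ∀ x, w 2 * w x = w 1 * w (x + 1) + w 1 * w (x - 1) := fun x => by
    have h3 := hw x 2
    have e1 : x + 2 - 1 = x + 1 := by ring
    have e2 : (2 : ℂ) - 1 = 1 := by ring
    rw [e1, e2] at h3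
    linear_combination h3
  rw [sum_cartan_mul N w h0 _ (by simp [h0]) hN hi]
  rw [Finset.mem_Icc] at hi hi'
  split_ifs with hiN hii hii
  · subst hiN; subst hii
    rw [min_eq_right (by omega), max_eq_left (by omega), Nat.cast_sub (by omega), Nat.cast_one]
    have e : (i' : ℂ) - 1 - i' = -1 := by ring
    rw [e, hodd]
    ring
  · subst hiN
    rw [max_eq_right (by omega), Nat.cast_sub (by omega), Nat.cast_one, sub_self, h0]
    ring
  · subst hii
    rw [min_self, max_self, min_eq_right (by omega), max_eq_left (by omega), min_eq_left (by omega),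
      max_eq_right (by omega), Nat.cast_sub (by omega), hodd]
    push_cast
    -- The Wronskian of the two branches at the kink: it equals w(N-1) w(1), independently of i'.
    have h3 := hw (i' + 1) (N - 1 - i')
    have e1 : (i' : ℂ) + 1 + (N - 1 - i') - 1 = N - 1 := by ring
    have e2 : (i' : ℂ) + 1 - 1 = i' := by ring
    have e3 : (N : ℂ) - 1 - i' - 1 = N - 1 - (i' + 1) := by ring
    rw [e1, e2, e3] at h3
    linear_combination w 1 * h3 + w (N - 1 - i') * h2 i'
  · rcases lt_or_gt_of_ne hii with hlt | hgt
    · rw [min_eq_left (by omega), max_eq_right (by omega), min_eq_left (by omega),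
        max_eq_right (by omega), min_eq_left (by omega), max_eq_right (by omega),
        Nat.cast_sub (by omega), hodd]
      push_cast
      have h3 := h2 (N - 1 - i)
      have e1 : (N : ℂ) - 1 - i + 1 = N - 1 - (i - 1) := by ring
      have e3 : (N : ℂ) - 1 - i - 1 = N - 1 - (i + 1) := by ring
      rw [e1, e3] at h3
      linear_combination w i' * h3
    · rw [min_eq_right (by omega), max_eq_left (by omega), min_eq_right (by omega),
        max_eq_left (by omega), min_eq_right (by omega), max_eq_left (by omega),
        Nat.cast_sub (by omega), hodd]
      push_cast
      linear_combination w (N - 1 - i') * h2 i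

theorem qPow_add (ℓ x y : ℂ) : qPow ℓ (x + y) = qPow ℓ x * qPow ℓ y := by
  rw [qPow, add_mul, Complex.exp_add]; rfl

theorem qPow_zero (ℓ : ℂ) : qPow ℓ 0 = 1 := by simp [qPow]

theorem qPow_ne_zero (ℓ x : ℂ) : qPow ℓ x ≠ 0 := Complex.exp_ne_zero _

theorem qPow_neg (ℓ x : ℂ) : qPow ℓ (-x) = (qPow ℓ x)⁻¹ := by
  rw [qPow, neg_mul, Complex.exp_neg]; rfl

theorem qPow_mul_natCast (ℓ x : ℂ) (m : ℕ) : qPow ℓ (x * m) = qPow ℓ x ^ m := by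
  rw [qPow, qPow, ← Complex.exp_nat_mul]
  congr 1
  ring

/-- All terms have the same denominator, so this is a Laurent polynomial identity in q^{(x-1)m},
q^{(y-1)m} and q^m. -/
theorem qInt_add_formula (ℓ : ℂ) (m x y : ℂ) :
    qInt ℓ (x * m) * qInt ℓ (y * m) - qInt ℓ ((x - 1) * m) * qInt ℓ ((y - 1) * m) =
      qInt ℓ ((x + y - 1) * m) * qInt ℓ (1 * m) := by
  have e : ∀ t, qPow ℓ (-(t * m)) = (qPow ℓ (t * m))⁻¹ := fun t => qPow_neg ℓ _
  have ex : qPow ℓ (x * m) = qPow ℓ ((x - 1) * m) * qPow ℓ (1 * m) := by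
    rw [← qPow_add]; congr 1; ring
  have ey : qPow ℓ (y * m) = qPow ℓ ((y - 1) * m) * qPow ℓ (1 * m) := by
    rw [← qPow_add]; congr 1; ring
  have exy : qPow ℓ ((x + y - 1) * m) =
      qPow ℓ ((x - 1) * m) * qPow ℓ ((y - 1) * m) * qPow ℓ (1 * m) := by
    rw [← qPow_add, ← qPow_add]; congr 1; ring
  simp only [qInt, e, ex, ey, exy]
  have h1 := qPow_ne_zero ℓ ((x - 1) * m)
  have h2 := qPow_ne_zero ℓ ((y - 1) * m)
  have h3 := qPow_ne_zero ℓ (1 * m)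
  rw [div_mul_div_comm, div_mul_div_comm, div_mul_div_comm, ← sub_div]
  congr 1
  generalize qPow ℓ ((x - 1) * m) = a at *
  generalize qPow ℓ ((y - 1) * m) = b at *
  generalize qPow ℓ (1 * m) = c at *
  field_simp
  ring

/-- For real y the modulus of q^y is exp(y Re ℓ), which separates q^y from q^{-y} when y ≠ 0. -/
theorem qInt_ne_zero {ℓ : ℂ} (hℓ : ℓ.re < 0) {x : ℝ} (hx : x ≠ 0) : qInt ℓ x ≠ 0 := by
  have key : ∀ y : ℝ, y ≠ 0 → qPow ℓ y - qPow ℓ (-y) ≠ 0 := by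
    intro y hy h
    have h1 := congrArg norm (sub_eq_zero.1 h)
    rw [qPow, qPow, Complex.norm_exp, Complex.norm_exp, ← Complex.ofReal_neg, Complex.re_ofReal_mul,
      Complex.re_ofReal_mul, Real.exp_eq_exp] at h1
    have h2 : y * ℓ.re = 0 := by linarith
    rcases mul_eq_zero.1 h2 with h3 | h3
    · exact hy h3
    · exact hℓ.ne h3
  have h1 := key 1 one_ne_zero
  rw [Complex.ofReal_one] at h1
  exact div_ne_zero (key x hx) h1

end CartanInverse

/-- Combines the oscillator relation with the zero-mode factor μ = t, as needed for a_+. -/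
theorem smul_exchange {R : Type*} [Ring R] [Algebra ℂ R] {a b c d : R} {t : ℂ} (ht : t ≠ 0)
    (h : a - t • b = c - t⁻¹ • d) : t • a - t • t • b = t • c - d := by
  rw [← smul_sub, h, smul_sub, smul_inv_smul₀ ht]

/-- The counterpart for a_-: the roles of the two operators are swapped and μ = t⁻¹. -/
theorem smul_exchange' {R : Type*} [Ring R] [Algebra ℂ R] {a b c d : R} {t : ℂ} (ht : t ≠ 0)
    (h : a - t • b = c - t⁻¹ • d) : t⁻¹ • d - t • t⁻¹ • c = t • b - a := by
  rw [smul_inv_smul₀ ht, ← neg_sub, ← h, neg_sub]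

/-! ### The exponent of the elementary vertex operator and its commutators. -/

section VertexField

variable {N : ℕ} {ℓ k : ℂ}

/-- The exponent of the elementary vertex operator. -/
noncomputable def vertexField (N : ℕ) (ℓ k : ℂ) (l : Idx N → ℂ) (β : ℂ) : LinField N :=
  ∑ i : Idx N, ∑ j : Idx N,
    ratioField N ℓ [l i, ((min i.1 j.1 : ℕ) : ℂ), (N : ℂ) - 1 - ((max i.1 j.1 : ℕ) : ℂ)]
      [k + N - 1, (N : ℂ) - 1, 1] (.inl j) β

theorem vertexOp_eq (l : Idx N → ℂ) (β : ℂ) :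
    vertexOp N ℓ k l β = normalExp N ℓ k (vertexField N ℓ k l β) := rfl

theorem vertexField_apply (l : Idx N → ℂ) (β : ℂ) (σ : Sym N) :
    vertexField N ℓ k l β σ = ∑ i : Idx N, ∑ j : Idx N,
      ratioField N ℓ [l i, ((min i.1 j.1 : ℕ) : ℂ), (N : ℂ) - 1 - ((max i.1 j.1 : ℕ) : ℂ)]
        [k + N - 1, (N : ℂ) - 1, 1] (.inl j) β σ := by
  simp only [vertexField, Finset.sum_apply]

theorem vertexField_mode_zero (l : Idx N → ℂ) (β : ℂ) (x : Boson N) :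
    vertexField N ℓ k l β (.mode x 0) = 0 := by
  rw [vertexField_apply]
  exact Finset.sum_eq_zero fun _ _ => Finset.sum_eq_zero fun _ _ => by simp [ratioField]

theorem vertexField_mode_inr (l : Idx N → ℂ) (β : ℂ) (p : Pair N ⊕ Pair N) (m : ℤ) :
    vertexField N ℓ k l β (.mode (.inr p) m) = 0 := by
  rw [vertexField_apply]
  exact Finset.sum_eq_zero fun _ _ => Finset.sum_eq_zero fun _ _ => by simp [ratioField]

theorem vertexField_Q_inr (l : Idx N → ℂ) (β : ℂ) (p : Pair N ⊕ Pair N) :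
    vertexField N ℓ k l β (.Q (.inr p)) = 0 := by
  rw [vertexField_apply]
  exact Finset.sum_eq_zero fun _ _ => Finset.sum_eq_zero fun _ _ => by simp [ratioField]

theorem vertexField_zlog_inr (l : Idx N → ℂ) (β : ℂ) (p : Pair N ⊕ Pair N) :
    vertexField N ℓ k l β (.zlog (.inr p)) = 0 := by
  rw [vertexField_apply]
  exact Finset.sum_eq_zero fun _ _ => Finset.sum_eq_zero fun _ _ => by simp [ratioField]

theorem vertexField_mode_inl (l : Idx N → ℂ) (β : ℂ) (j : Idx N) {m : ℤ} (hm : m ≠ 0) :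
    vertexField N ℓ k l β (.mode (.inl j) m) = ∑ i : Idx N,
      -(qInt ℓ (l i * m) * (qInt ℓ (((min i.1 j.1 : ℕ) : ℂ) * m)
          * qInt ℓ (((N : ℂ) - 1 - ((max i.1 j.1 : ℕ) : ℂ)) * m))
        / (qInt ℓ ((k + N - 1) * m) * (qInt ℓ (((N : ℂ) - 1) * m) * qInt ℓ (1 * m))))
        / qInt ℓ m * qPow ℓ (-β * |m|) := by
  rw [vertexField_apply]
  refine Finset.sum_congr rfl fun i _ => ?_
  rw [Finset.sum_eq_single j]
  · simp [ratioField, hm]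
  · intro j' _ hj
    simp [ratioField, hj.symm]
  · simp

theorem vertexField_Q_inl (l : Idx N → ℂ) (β : ℂ) (j : Idx N) :
    vertexField N ℓ k l β (.Q (.inl j)) = ∑ i : Idx N,
      (l i * (((min i.1 j.1 : ℕ) : ℂ) * ((N : ℂ) - 1 - ((max i.1 j.1 : ℕ) : ℂ))))
        / ((k + N - 1) * ((N : ℂ) - 1)) := by
  rw [vertexField_apply]
  refine Finset.sum_congr rfl fun i _ => ?_
  rw [Finset.sum_eq_single j]
  · simp [ratioField]
  · intro j' _ hj
    simp [ratioField, hj.symm]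
  · simp

theorem sum_idx (N : ℕ) (F : ℕ → ℂ) : ∑ j : Idx N, F j.1 = ∑ j ∈ Finset.Icc 1 N, F j :=
  Finset.sum_coe_sort (Finset.Icc 1 N) F

theorem vertexField_oscComm_inr (l : Idx N → ℂ) (β : ℂ) (p : Pair N ⊕ Pair N) (m n : ℤ) :
    ∑ y, vertexField N ℓ k l β (.mode y n) * oscComm N ℓ k (.inr p) y m = 0 := by
  refine Finset.sum_eq_zero fun y _ => ?_
  rcases y with j | p'
  · rcases p with p | p <;> simp [oscComm]
  · rw [vertexField_mode_inr, zero_mul]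

theorem charge_vertexField_inr (l : Idx N → ℂ) (β : ℂ) (p : Pair N ⊕ Pair N) :
    charge k (vertexField N ℓ k l β) (.inr p) = 0 := by
  refine Finset.sum_eq_zero fun y _ => ?_
  rcases y with j | p'
  · rcases p with p | p <;> simp [zeroComm]
  · dsimp only
    rw [vertexField_Q_inr, zero_mul]

/-- The factor [(k+N-1)m] of the commutator of a cancels the denominator of the exponent, which is
where the condition on the level enters. `cartan_inverse` with w(x) = [xm] then leaves only the term
of index i. -/
theorem vertexField_oscComm_inl (hN : 2 ≤ N) (hℓ : ℓ.re < 0) (l : Idx N → ℂ) (β : ℂ) (i : Idx N)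
    {m : ℤ} (hm : m ≠ 0) (hk : qInt ℓ ((k + N - 1) * m) ≠ 0) :
    ∑ y, vertexField N ℓ k l β (.mode y (-m)) * oscComm N ℓ k (.inl i) y m =
      qInt ℓ (l i * m) / m * qPow ℓ (-β * |m|) := by
  have hm1 : qInt ℓ (1 * m) ≠ 0 := by
    have := qInt_ne_zero hℓ (x := (m : ℝ)) (by exact_mod_cast hm)
    rwa [one_mul]
  have hN1 : qInt ℓ (((N : ℂ) - 1) * m) ≠ 0 := by
    have h1 : (N : ℝ) - 1 ≠ 0 := by
      have : (2 : ℝ) ≤ N := by exact_mod_cast hN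
      linarith
    have := qInt_ne_zero hℓ (x := ((N : ℝ) - 1) * m) (mul_ne_zero h1 (by exact_mod_cast hm))
    push_cast at this
    exact this
  have hm0 : (m : ℂ) ≠ 0 := by exact_mod_cast hm
  rw [Fintype.sum_sum_type, Finset.sum_eq_zero (s := (Finset.univ : Finset (Pair N ⊕ Pair N)))
    fun p _ => by rw [vertexField_mode_inr, zero_mul], add_zero]
  have h1 : ∀ j : Idx N, vertexField N ℓ k l β (.mode (.inl j) (-m)) *
      oscComm N ℓ k (.inl i) (.inl j) m = ∑ i' : Idx N,
      (qInt ℓ (l i' * m) / (qInt ℓ (((N : ℂ) - 1) * m) * qInt ℓ (1 * m) * qInt ℓ (1 * m)) / m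
        * qPow ℓ (-β * |m|)) *
      (qInt ℓ ((cartan N i j : ℂ) * m) * (qInt ℓ (((min i'.1 j.1 : ℕ) : ℂ) * m)
          * qInt ℓ (((N : ℂ) - 1 - ((max i'.1 j.1 : ℕ) : ℂ)) * m))) := by
    intro j
    rw [vertexField_mode_inl l β j (neg_ne_zero.2 hm), Finset.sum_mul]
    refine Finset.sum_congr rfl fun i' _ => ?_
    rw [Int.cast_neg, abs_neg, oscComm]
    simp only [mul_neg, qInt_neg]
    rw [one_mul] at hm1 ⊢
    generalize qInt ℓ ((k + N - 1) * m) = A at hk ⊢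
    generalize qInt ℓ ((N - 1) * m) = B at hN1 ⊢
    field_simp
  rw [Finset.sum_congr rfl fun j _ => h1 j, Finset.sum_comm]
  have h2 : ∀ i' : Idx N, ∑ j : Idx N,
      (qInt ℓ ((cartan N i j : ℂ) * m) * (qInt ℓ (((min i'.1 j.1 : ℕ) : ℂ) * m)
          * qInt ℓ (((N : ℂ) - 1 - ((max i'.1 j.1 : ℕ) : ℂ)) * m))) =
      if i' = i then qInt ℓ (((N : ℂ) - 1) * m) * qInt ℓ (1 * m) * qInt ℓ (1 * m) else 0 := by
    intro i'
    have h3 := cartan_inverse N hN (fun x => qInt ℓ (x * m))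
      (fun x => by rw [neg_mul, qInt_neg]) (qInt_add_formula ℓ m) i.2 i'.2
    rw [← sum_idx] at h3
    simp only [h3, Subtype.ext_iff]
  simp only [← Finset.mul_sum, h2, mul_ite, mul_zero]
  rw [Finset.sum_ite_eq', if_pos (Finset.mem_univ _)]
  generalize qInt ℓ ((N - 1) * m) = B at hN1 ⊢
  generalize qInt ℓ (1 * m) = C at hm1 ⊢
  field_simp

/-- The zero-mode analogue: `cartan_inverse` with w(x) = x. -/
theorem charge_vertexField_inl (hN : 2 ≤ N) (hk : k + N - 1 ≠ 0) (l : Idx N → ℂ) (β : ℂ)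
    (i : Idx N) : charge k (vertexField N ℓ k l β) (.inl i) = l i := by
  have hN1 : (N : ℂ) - 1 ≠ 0 := by
    rw [sub_ne_zero]
    exact_mod_cast (by omega : N ≠ 1)
  rw [charge, shift, Fintype.sum_sum_type,
    Finset.sum_eq_zero (s := (Finset.univ : Finset (Pair N ⊕ Pair N)))
    fun p _ => by rw [vertexField_Q_inr, zero_mul], add_zero]
  have h1 : ∀ j : Idx N, vertexField N ℓ k l β (.Q (.inl j)) *
      zeroComm N k (.inl i) (.inl j) = ∑ i' : Idx N, (l i' / ((N : ℂ) - 1)) *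
      ((cartan N i j : ℂ) * (((min i'.1 j.1 : ℕ) : ℂ) *
        ((N : ℂ) - 1 - ((max i'.1 j.1 : ℕ) : ℂ)))) := by
    intro j
    rw [vertexField_Q_inl l β j, Finset.sum_mul]
    refine Finset.sum_congr rfl fun i' _ => ?_
    rw [zeroComm]
    field_simp
  rw [Finset.sum_congr rfl fun j _ => h1 j, Finset.sum_comm]
  have h2 : ∀ i' : Idx N, ∑ j : Idx N, ((cartan N i j : ℂ) * (((min i'.1 j.1 : ℕ) : ℂ) *
      ((N : ℂ) - 1 - ((max i'.1 j.1 : ℕ) : ℂ)))) = if i' = i then ((N : ℂ) - 1) * 1 * 1 else 0 := by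
    intro i'
    have h3 := cartan_inverse N hN (fun x => x) (fun x => rfl) (fun x y => by ring) i.2 i'.2
    rw [← sum_idx] at h3
    simp only [h3, Subtype.ext_iff]
  simp only [← Finset.mul_sum, h2, mul_ite, mul_zero]
  rw [Finset.sum_ite_eq', if_pos (Finset.mem_univ _)]
  field_simp

theorem pairing_vertexField_right (hN : 2 ≤ N) (hℓ : ℓ.re < 0) (l : Idx N → ℂ) (β : ℂ)
    (f : LinField N) {m : ℤ} (hm : m ≠ 0) (hk : qInt ℓ ((k + N - 1) * m) ≠ 0) :
    pairing ℓ k f (vertexField N ℓ k l β) m =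
      ∑ i : Idx N, f (.mode (.inl i) m) * (qInt ℓ (l i * m) / m * qPow ℓ (-β * |m|)) := by
  simp only [pairing, mul_assoc, ← Finset.mul_sum]
  rw [Fintype.sum_sum_type, Finset.sum_eq_zero (s := (Finset.univ : Finset (Pair N ⊕ Pair N)))
    fun p _ => by rw [vertexField_oscComm_inr, mul_zero], add_zero]
  exact Finset.sum_congr rfl fun i _ => by rw [vertexField_oscComm_inl hN hℓ l β i hm hk]

/-- Lets the contraction in the opposite order be computed from `pairing_vertexField_right` at -m.
-/
theorem pairing_neg (f g : LinField N) (m : ℤ) : pairing ℓ k f g m = -pairing ℓ k g f (-m) := by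
  rw [pairing, pairing, Finset.sum_comm, ← Finset.sum_neg_distrib]
  refine Finset.sum_congr rfl fun x _ => ?_
  rw [← Finset.sum_neg_distrib]
  refine Finset.sum_congr rfl fun y _ => ?_
  rw [oscComm_neg, neg_neg]
  ring

/-! ### Fields without the bosons `a` -/

/-- The linear fields in which the bosons `a^i` do not occur. -/
def ghostFields (N : ℕ) : Submodule ℂ (LinField N) where
  carrier := {f | ∀ i, (∀ m, f (.mode (.inl i) m) = 0) ∧ f (.Q (.inl i)) = 0 ∧ f (.zlog (.inl i)) = 0}
  add_mem' {f g} hf hg i := by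
    simp [(hf i).1, (hf i).2.1, (hf i).2.2, (hg i).1, (hg i).2.1, (hg i).2.2]
  zero_mem' i := by simp
  smul_mem' c f hf i := by
    simp [(hf i).1, (hf i).2.1, (hf i).2.2]

theorem b_mem (i j : ℕ) (s : ℂ) : b N ℓ i j s ∈ ghostFields N := by
  unfold b
  split_ifs
  · intro i; simp [rescale, full]
  · exact zero_mem _

theorem c_mem (i j : ℕ) (s : ℂ) : c N ℓ i j s ∈ ghostFields N := by
  unfold c
  split_ifs
  · intro i; simp [rescale, full]
  · exact zero_mem _

theorem bP_mem (i j : ℕ) (s : ℂ) : bP N ℓ i j s ∈ ghostFields N := by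
  unfold bP
  split_ifs
  · intro i; simp [rescale, plusPart]
  · exact zero_mem _

theorem bM_mem (i j : ℕ) (s : ℂ) : bM N ℓ i j s ∈ ghostFields N := by
  unfold bM
  split_ifs
  · intro i; simp [rescale, minusPart]
  · exact zero_mem _

theorem bc_mem (i j : ℕ) (s : ℂ) : bc N ℓ i j s ∈ ghostFields N :=
  add_mem (b_mem i j s) (c_mem i j s)

theorem tailM_mem (i r : ℕ) : tailM N ℓ k i r ∈ ghostFields N :=
  sub_mem (add_mem (sum_mem fun _ _ => sub_mem (bM_mem _ _ _) (bM_mem _ _ _)) (bM_mem _ _ _))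
    (bM_mem _ _ _)

theorem tailP_mem (i r : ℕ) : tailP N ℓ k i r ∈ ghostFields N :=
  sub_mem (add_mem (sum_mem fun _ _ => sub_mem (bP_mem _ _ _) (bP_mem _ _ _)) (bP_mem _ _ _))
    (bP_mem _ _ _)

theorem xPlus1_mem (i j : ℕ) : xPlus1 N ℓ i j ∈ ghostFields N :=
  add_mem (sub_mem (add_mem (bc_mem _ _ _) (bP_mem _ _ _)) (bc_mem _ _ _))
    (sum_mem fun _ _ => sub_mem (bP_mem _ _ _) (bP_mem _ _ _))

theorem xPlus2_mem (i j : ℕ) : xPlus2 N ℓ i j ∈ ghostFields N :=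
  add_mem (sub_mem (add_mem (bc_mem _ _ _) (bM_mem _ _ _)) (bc_mem _ _ _))
    (sum_mem fun _ _ => sub_mem (bP_mem _ _ _) (bP_mem _ _ _))

theorem xPlusN_mem (j : ℕ) : xPlusN N ℓ j ∈ ghostFields N :=
  sub_mem (add_mem (bc_mem _ _ _) (b_mem _ _ _))
    (sum_mem fun _ _ => add_mem (bP_mem _ _ _) (bP_mem _ _ _))

/-- The fields whose part in the bosons `a` is that of `A`. -/
def HasMatterPart (A f : LinField N) : Prop := f - A ∈ ghostFields N

namespace HasMatterPart

theorem refl (A : LinField N) : HasMatterPart A A := by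
  unfold HasMatterPart
  rw [sub_self]
  exact zero_mem _

theorem add {A f g : LinField N} (hf : HasMatterPart A f) (hg : g ∈ ghostFields N) :
    HasMatterPart A (f + g) := by
  unfold HasMatterPart
  rw [add_sub_right_comm]
  exact add_mem hf hg

theorem sub {A f g : LinField N} (hf : HasMatterPart A f) (hg : g ∈ ghostFields N) :
    HasMatterPart A (f - g) := by
  unfold HasMatterPart
  rw [sub_right_comm]
  exact sub_mem hf hg

end HasMatterPart

theorem xMinus1_matter_aM {i j : ℕ} (hj : j ≤ i) :
    HasMatterPart (aM N ℓ i (-((k + N - 1) / 2))) (xMinus1 N ℓ k i j) := by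
  unfold xMinus1
  split_ifs
  · exact ((((((HasMatterPart.refl _).add (bc_mem _ _ _)).sub (bM_mem _ _ _)).sub
      (bc_mem _ _ _)).add (sum_mem fun _ _ => sub_mem (bM_mem _ _ _) (bM_mem _ _ _))).add
        (tailM_mem _ _))
  · exact ((HasMatterPart.refl _).add (bc_mem _ _ _)).add (tailM_mem _ _)
  · omega

theorem xMinus1_matter_aP {i j : ℕ} (hj : i < j) :
    HasMatterPart (aP N ℓ i ((k + N - 1) / 2)) (xMinus1 N ℓ k i j) := by
  unfold xMinus1
  rw [if_neg (by omega), if_neg (by omega)]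
  exact ((((HasMatterPart.refl _).add (bc_mem _ _ _)).add (bP_mem _ _ _)).sub (bc_mem _ _ _)).add
    (tailP_mem _ _)

theorem xMinus2_matter_aM {i j : ℕ} (hj : j < i) :
    HasMatterPart (aM N ℓ i (-((k + N - 1) / 2))) (xMinus2 N ℓ k i j) := by
  unfold xMinus2
  rw [if_pos hj]
  exact ((((((HasMatterPart.refl _).add (bc_mem _ _ _)).sub (bP_mem _ _ _)).sub
    (bc_mem _ _ _)).add (sum_mem fun _ _ => sub_mem (bM_mem _ _ _) (bM_mem _ _ _))).add
      (tailM_mem _ _))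

theorem xMinus2_matter_aP {i j : ℕ} (hj : i ≤ j) :
    HasMatterPart (aP N ℓ i ((k + N - 1) / 2)) (xMinus2 N ℓ k i j) := by
  unfold xMinus2
  rw [if_neg (by omega)]
  split_ifs
  · exact ((HasMatterPart.refl _).add (bc_mem _ _ _)).add (tailP_mem _ _)
  · exact ((((HasMatterPart.refl _).add (bc_mem _ _ _)).add (bM_mem _ _ _)).sub (bc_mem _ _ _)).add
      (tailP_mem _ _)

theorem xMinus0_matter_aP (i : ℕ) :
    HasMatterPart (aP N ℓ i ((k + N - 1) / 2)) (xMinus0 N ℓ k i) :=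
  (((HasMatterPart.refl _).sub (b_mem _ _ _)).sub (bP_mem _ _ _)).add (b_mem _ _ _)

theorem xMinusN1_matter_aM (j : ℕ) :
    HasMatterPart (aM N ℓ N (-((k + N - 1) / 2))) (xMinusN1 N ℓ k j) := by
  unfold xMinusN1
  split_ifs
  · exact (HasMatterPart.refl _).sub (b_mem _ _ _)
  · exact (((((HasMatterPart.refl _).sub (bM_mem _ _ _)).sub (bc_mem _ _ _)).sub
      (bM_mem _ _ _)).sub (b_mem _ _ _)).sub (sum_mem fun _ _ => add_mem (bM_mem _ _ _) (bM_mem _ _ _))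

/-- Only the summand j = N carries a_+, hence the alternative. -/
theorem xMinusN2_matter (j : ℕ) :
    HasMatterPart (aM N ℓ N (-((k + N - 1) / 2))) (xMinusN2 N ℓ k j) ∨
      HasMatterPart (aP N ℓ N ((k + N - 1) / 2)) (xMinusN2 N ℓ k j) := by
  unfold xMinusN2
  split_ifs
  · exact .inr ((HasMatterPart.refl _).sub (b_mem _ _ _))
  · exact .inl ((((((HasMatterPart.refl _).sub (bP_mem _ _ _)).sub (bc_mem _ _ _)).sub
      (bP_mem _ _ _)).sub (b_mem _ _ _)).sub
        (sum_mem fun _ _ => add_mem (bM_mem _ _ _) (bM_mem _ _ _)))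

/-! ### Exchange with the elementary vertex operator -/

/-- The vertex operator shifts only the momenta of a, by `l`; the field `f` has no Q_a and no a_0
log z, and the cocycle sees only b. The one surviving effect is that the a_0 in the exponent of `f`
measure the charge `l`. -/
theorem zeroModeExchange_vertexField (hN : 2 ≤ N) (hk : k + N - 1 ≠ 0) (l : Idx N → ℂ) (β : ℂ)
    {f : LinField N} (hQ : ∀ i, f (.Q (.inl i)) = 0) (hz : ∀ i, f (.zlog (.inl i)) = 0) :
    ZeroModeExchange k f (vertexField N ℓ k l β)
      (Complex.exp (∑ i, f (.mode (.inl i) 0) * l i)) where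
  zExponent_left p := by
    refine Finset.sum_congr rfl fun x _ => ?_
    rcases x with i | x
    · rw [hz, zero_mul, zero_mul]
    · rw [Pi.add_apply, charge_vertexField_inr, add_zero]
  zExponent_right p := by
    refine Finset.sum_congr rfl fun x _ => ?_
    rcases x with i | x
    · have h1 : charge k f (.inl i) = 0 := by
        refine Finset.sum_eq_zero fun y _ => ?_
        rcases y with j | p | p
        · dsimp only
          rw [hQ, zero_mul]
        · exact mul_zero _
        · exact mul_zero _
      rw [Pi.add_apply, h1, add_zero]
    · rw [vertexField_zlog_inr, zero_mul, zero_mul]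
  zeroFactor_left p := by
    have h1 : ∑ x, f (.mode x 0) * (p + charge k (vertexField N ℓ k l β)) x =
        ∑ i, f (.mode (.inl i) 0) * l i + ∑ x, f (.mode x 0) * p x := by
      simp only [Pi.add_apply, mul_add, Finset.sum_add_distrib]
      rw [add_comm]
      congr 1
      rw [Fintype.sum_sum_type, Finset.sum_eq_zero (s := (Finset.univ : Finset (Pair N ⊕ Pair N)))
        fun p _ => by rw [charge_vertexField_inr, mul_zero], add_zero]
      exact Finset.sum_congr rfl fun i _ => by rw [charge_vertexField_inl hN hk]
    have h2 : ∀ i, odd (p + charge k (vertexField N ℓ k l β)) i = odd p i := by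
      intro i
      unfold odd
      split_ifs
      · rw [Pi.add_apply, charge_vertexField_inr, add_zero]
      · rfl
    simp only [zeroFactor, cocycle, h1, h2, Complex.exp_add]
    ring
  zeroFactor_right p := by
    have h2 : ∀ i, odd (fun x => vertexField N ℓ k l β (.Q x)) i = 0 := by
      intro i
      unfold odd
      split_ifs
      · exact vertexField_Q_inr _ _ _
      · rfl
    simp only [zeroFactor, cocycle, h2, vertexField_mode_zero, zero_mul, mul_zero, sub_self,
      ite_self, Finset.sum_const_zero]

theorem normalExp_commute_vertexOp (hN : 2 ≤ N) (hℓ : ℓ.re < 0) (hk0 : k + N - 1 ≠ 0)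
    (hk : ∀ m : ℤ, m ≠ 0 → qInt ℓ ((k + N - 1) * m) ≠ 0) (l : Idx N → ℂ) (β : ℂ) {f : LinField N}
    (hf : f ∈ ghostFields N) (e₁ e₂ : ℂ) :
    Commute (normalExp N ℓ k f e₁) (vertexOp N ℓ k l β e₂) := by
  have h1 := zeroModeExchange_vertexField (ℓ := ℓ) hN hk0 l β (fun i => (hf i).2.1)
    (fun i => (hf i).2.2)
  simp only [(hf _).1, zero_mul, Finset.sum_const_zero, Complex.exp_zero] at h1
  have h2 : ∀ m : ℤ, m ≠ 0 → pairing ℓ k f (vertexField N ℓ k l β) m = 0 := by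
    intro m hm
    rw [pairing_vertexField_right hN hℓ l β f hm (hk m hm)]
    exact Finset.sum_eq_zero fun i _ => by rw [(hf i).1, zero_mul]
  refine normalExp_commute h1 (commute_oscVertex_oscVertex (fun m hm => h2 m (by omega)) ?_) e₁ e₂
  intro m hm
  rw [pairing_neg, h2 _ (by omega), neg_zero]

theorem qPow_one_sub_ne_zero (hℓ : ℓ.re < 0) : qPow ℓ 1 - qPow ℓ (-1) ≠ 0 := by
  intro h
  refine qInt_ne_zero hℓ (x := 1) one_ne_zero ?_
  rw [qInt, h, div_zero]

theorem mul_qInt (hℓ : ℓ.re < 0) (x : ℂ) (m : ℕ) :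
    (qPow ℓ 1 - qPow ℓ (-1)) * qInt ℓ (x * m) = qPow ℓ x ^ m - (qPow ℓ x)⁻¹ ^ m := by
  rw [qInt, mul_div_cancel₀ _ (qPow_one_sub_ne_zero hℓ), qPow_neg, qPow_mul_natCast, inv_pow]

/-- The argument q^s z multiplies the mode m > 0 by q^{-sm}, and β = -s gives q^{sm}, so the
contraction depends on q^{l i} alone. As a_+ has no modes m < 0, the opposite contraction is
trivial, and a_0 log q yields μ = q^{l i}. -/
theorem exchanges_of_aP (hN : 2 ≤ N) (hℓ : ℓ.re < 0) (hk0 : k + N - 1 ≠ 0)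
    (hk : ∀ m : ℤ, m ≠ 0 → qInt ℓ ((k + N - 1) * m) ≠ 0) (l : Idx N → ℂ) (s : ℂ) (i : Idx N)
    {f : LinField N} (hf : HasMatterPart (aP N ℓ i s) f) :
    Exchanges (vertexOp N ℓ k l (-s)) (qPow ℓ (l i)) (normalExp N ℓ k f) := by
  rw [aP, dif_pos i.2] at hf
  have hQ : ∀ j, f (.Q (.inl j)) = 0 := fun j => sub_eq_zero.1 (hf j).2.1
  have hz : ∀ j, f (.zlog (.inl j)) = 0 := fun j => sub_eq_zero.1 (hf j).2.2
  have hm : ∀ j m, f (.mode (.inl j) m) = if j = i then qPow ℓ (-s * m) *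
      (if 0 < m then qPow ℓ 1 - qPow ℓ (-1) else if m = 0 then ℓ else 0) else 0 := by
    intro j m
    rw [sub_eq_zero.1 ((hf j).1 m)]
    simp [rescale, plusPart]
  have hμ : Complex.exp (∑ j, f (.mode (.inl j) 0) * l j) = qPow ℓ (l i) := by
    simp only [hm, ite_mul, zero_mul]
    rw [Finset.sum_ite_eq', if_pos (Finset.mem_univ _)]
    simp [qPow, mul_comm]
  have h1 := zeroModeExchange_vertexField (ℓ := ℓ) hN hk0 l (-s) hQ hz
  rw [hμ] at h1
  have h2 : ∀ m : ℕ, m ≠ 0 → pairing ℓ k f (vertexField N ℓ k l (-s)) m =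
      (qPow ℓ (l i) ^ m - (qPow ℓ (l i))⁻¹ ^ m) / m := by
    intro m hm0
    have hm1 : (m : ℤ) ≠ 0 := by exact_mod_cast hm0
    rw [pairing_vertexField_right hN hℓ l (-s) f hm1 (hk m hm1)]
    simp only [hm, ite_mul, zero_mul]
    rw [Finset.sum_ite_eq', if_pos (Finset.mem_univ _), if_pos (by omega), ← mul_qInt hℓ]
    have h3 : qPow ℓ (-s * (m : ℤ)) * qPow ℓ (-(-s) * |(m : ℤ)|) = 1 := by
      rw [← qPow_add, Nat.abs_cast, neg_neg, neg_mul, neg_add_cancel, qPow_zero]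
    simp only [Int.cast_natCast] at h3 ⊢
    linear_combination (qPow ℓ 1 - qPow ℓ (-1)) * qInt ℓ (l i * m) / m * h3
  have h4 : ∀ m : ℕ, m ≠ 0 → pairing ℓ k (vertexField N ℓ k l (-s)) f m = 0 := by
    intro m hm0
    have hm1 : -(m : ℤ) ≠ 0 := by omega
    rw [pairing_neg, pairing_vertexField_right hN hℓ l (-s) f hm1 (hk _ hm1), neg_eq_zero]
    refine Finset.sum_eq_zero fun j _ => ?_
    rw [hm, if_neg (by omega : ¬ 0 < -(m : ℤ)), if_neg hm1]
    simp
  refine normalExp_exchanges h1 fun n m => ?_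
  exact smul_exchange (qPow_ne_zero ℓ (l i)) (oscVertex_exchange h2 h4 n m)

/-- Here only modes m < 0 occur, so the nontrivial contraction has the vertex operator on the left,
and -a_0 log q yields μ = q^{-l i}. -/
theorem exchanges_of_aM (hN : 2 ≤ N) (hℓ : ℓ.re < 0) (hk0 : k + N - 1 ≠ 0)
    (hk : ∀ m : ℤ, m ≠ 0 → qInt ℓ ((k + N - 1) * m) ≠ 0) (l : Idx N → ℂ) (s : ℂ) (i : Idx N)
    {f : LinField N} (hf : HasMatterPart (aM N ℓ i (-s)) f) :
    Exchanges (vertexOp N ℓ k l (-s)) (qPow ℓ (l i)) (normalExp N ℓ k f) := by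
  rw [aM, dif_pos i.2] at hf
  have hQ : ∀ j, f (.Q (.inl j)) = 0 := fun j => sub_eq_zero.1 (hf j).2.1
  have hz : ∀ j, f (.zlog (.inl j)) = 0 := fun j => sub_eq_zero.1 (hf j).2.2
  have hm : ∀ j m, f (.mode (.inl j) m) = if j = i then qPow ℓ (s * m) *
      (if m < 0 then -(qPow ℓ 1 - qPow ℓ (-1)) else if m = 0 then -ℓ else 0) else 0 := by
    intro j m
    rw [sub_eq_zero.1 ((hf j).1 m)]
    simp [rescale, minusPart]
  have hμ : Complex.exp (∑ j, f (.mode (.inl j) 0) * l j) = (qPow ℓ (l i))⁻¹ := by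
    simp only [hm, ite_mul, zero_mul]
    rw [Finset.sum_ite_eq', if_pos (Finset.mem_univ _), ← qPow_neg]
    simp [qPow, mul_comm]
  have h1 := zeroModeExchange_vertexField (ℓ := ℓ) hN hk0 l (-s) hQ hz
  rw [hμ] at h1
  have h2 : ∀ m : ℕ, m ≠ 0 → pairing ℓ k (vertexField N ℓ k l (-s)) f m =
      (qPow ℓ (l i) ^ m - (qPow ℓ (l i))⁻¹ ^ m) / m := by
    intro m hm0
    have hm1 : -(m : ℤ) ≠ 0 := by omega
    rw [pairing_neg, pairing_vertexField_right hN hℓ l (-s) f hm1 (hk _ hm1)]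
    simp only [hm, ite_mul, zero_mul]
    rw [Finset.sum_ite_eq', if_pos (Finset.mem_univ _), if_pos (by omega), ← mul_qInt hℓ]
    have h3 : qPow ℓ (s * (-(m : ℤ) : ℤ)) * qPow ℓ (-(-s) * |-(m : ℤ)|) = 1 := by
      rw [← qPow_add, abs_neg, Nat.abs_cast, neg_neg, Int.cast_neg, mul_neg, neg_add_cancel, qPow_zero]
    simp only [Int.cast_natCast, Int.cast_neg, mul_neg, qInt_neg, neg_div_neg_eq] at h3 ⊢
    linear_combination (qPow ℓ 1 - qPow ℓ (-1)) * qInt ℓ (l i * m) / m * h3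
  have h4 : ∀ m : ℕ, m ≠ 0 → pairing ℓ k f (vertexField N ℓ k l (-s)) m = 0 := by
    intro m hm0
    have hm1 : (m : ℤ) ≠ 0 := by omega
    rw [pairing_vertexField_right hN hℓ l (-s) f hm1 (hk _ hm1)]
    refine Finset.sum_eq_zero fun j _ => ?_
    rw [hm, if_neg (by omega : ¬ (m : ℤ) < 0), if_neg hm1]
    simp
  refine normalExp_exchanges h1 fun n m => ?_
  exact smul_exchange' (qPow_ne_zero ℓ (l i)) (oscVertex_exchange h2 h4 m n)

end VertexField

/-! ### The relations with the Drinfeld generators. -/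

section Relations

variable {N : ℕ} {ℓ k : ℂ}

theorem lie_add_of_commute {R : Type*} [Ring R] [Algebra ℂ R] {a b S T : R} {c κ : ℂ}
    (ha : a * S - S * a = κ • T) (hb : Commute b S) :
    (c • a + b) * S - S * (c • a + b) = (c * κ) • T := by
  rw [add_mul, mul_add, hb.eq, add_sub_add_right_eq_sub, smul_mul_assoc, mul_smul_comm, ← smul_sub,
    ha, smul_smul]

theorem commute_neg_left {R : Type*} [Ring R] {a b : R} (h : Commute a b) : Commute (-a) b :=
  h.neg_left

theorem bMode_commute_vertexOp (l : Idx N → ℂ) (β e : ℂ) (i j : ℕ) (m : ℤ) :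
    Commute (bMode N ℓ k i j m) (vertexOp N ℓ k l β e) := by
  unfold bMode
  split_ifs with h
  · refine sub_eq_zero.1 ?_
    rw [vertexOp_eq]
    rcases eq_or_ne m 0 with rfl | hm
    · rw [mode_zero_lie_normalExp, charge_vertexField_inr, zero_smul]
    · rw [mode_lie_normalExp _ _ hm, vertexField_oscComm_inr, zero_smul]
  · exact Commute.zero_left _

/-- Only the commutation of the b-part `B` with `T` matters afterwards, so its explicit form is
hidden. -/
theorem h_eq_add (T : Module.End ℂ (Fock N)) (m : ℤ)
    (hT : ∀ i j, Commute (bMode N ℓ k i j m) T) (i : Idx N) :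
    ∃ B, Commute B T ∧ h N ℓ k i m =
      qPow ℓ (-((N - 1 : ℂ) / 2) * |m|) • mode N ℓ k (.inl i) m + B := by
  have ha : aMode N ℓ k i m = mode N ℓ k (.inl i) m := by rw [aMode, dif_pos i.2]
  have hs : ∀ (c : ℂ) i j, Commute (c • bMode N ℓ k i j m) T := fun c i j => (hT i j).smul_left c
  unfold h
  split_ifs with hi
  · have ha' : aMode N ℓ k N m = mode N ℓ k (.inl i) m := by rw [← ha, hi]
    rw [ha']
    refine ⟨_, ?_, sub_eq_add_neg (G := Module.End ℂ (Fock N)) _ _⟩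
    exact commute_neg_left (R := Module.End ℂ (Fock N))
      (Commute.sum_left _ _ _ fun _ _ => (hs _ _ _).add_left (hs _ _ _))
  · rw [ha, add_assoc, add_assoc]
    refine ⟨_, ?_, add_sub_assoc (G := Module.End ℂ (Fock N)) _ _ _⟩
    refine Commute.sub_left (R := Module.End ℂ (Fock N))
      (Commute.add_left ?_ (Commute.add_left ?_ (hs _ _ _))) (hs _ _ _)
    · exact Commute.sum_left _ _ _ fun _ _ =>
        Commute.sub_left (R := Module.End ℂ (Fock N)) (hs _ _ _) (hs _ _ _)
    · exact Commute.sum_left _ _ _ fun _ _ =>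
        Commute.sub_left (R := Module.End ℂ (Fock N)) (hs _ _ _) (hs _ _ _)

theorem h_lie_vertexOp (hN : 2 ≤ N) (hℓ : ℓ.re < 0)
    (hk : ∀ m : ℤ, m ≠ 0 → qInt ℓ ((k + N - 1) * m) ≠ 0) (l : Idx N → ℂ) (i : Idx N) (β : ℂ)
    {m : ℤ} (hm : m ≠ 0) (e : ℂ) :
    h N ℓ k i m * vertexOp N ℓ k l β e - vertexOp N ℓ k l β e * h N ℓ k i m =
      (qInt ℓ (l i * m) / m * qPow ℓ (-(β + ((N : ℂ) - 1) / 2) * |m|)) •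
        vertexOp N ℓ k l β (e - m) := by
  obtain ⟨B, hB, hh⟩ := h_eq_add _ m (fun a b => bMode_commute_vertexOp l β e a b m) i
  have h1 := mode_lie_normalExp (ℓ := ℓ) (k := k) (.inl i) (vertexField N ℓ k l β) hm e
  rw [vertexField_oscComm_inl hN hℓ l β i hm (hk m hm)] at h1
  rw [hh]
  refine (lie_add_of_commute (R := Module.End ℂ (Fock N)) h1 hB).trans ?_
  rw [← vertexOp_eq]
  congr 1
  rw [mul_left_comm, ← qPow_add]
  congr 2
  ring

theorem h_zero_lie_vertexOp (hN : 2 ≤ N) (hk0 : k + N - 1 ≠ 0) (l : Idx N → ℂ) (i : Idx N)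
    (β e : ℂ) :
    h N ℓ k i 0 * vertexOp N ℓ k l β e - vertexOp N ℓ k l β e * h N ℓ k i 0 =
      l i • vertexOp N ℓ k l β e := by
  obtain ⟨B, hB, hh⟩ := h_eq_add _ 0 (fun a b => bMode_commute_vertexOp l β e a b 0) i
  have h1 := mode_zero_lie_normalExp (ℓ := ℓ) (k := k) (.inl i) (vertexField N ℓ k l β) e
  rw [charge_vertexField_inl hN hk0] at h1
  rw [hh]
  refine (lie_add_of_commute (R := Module.End ℂ (Fock N)) h1 hB).trans ?_
  rw [abs_zero, Int.cast_zero, mul_zero, qPow_zero, one_mul]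
  rfl

theorem xPlus_commute_vertexOp (hN : 2 ≤ N) (hℓ : ℓ.re < 0) (hk0 : k + N - 1 ≠ 0)
    (hk : ∀ m : ℤ, m ≠ 0 → qInt ℓ ((k + N - 1) * m) ≠ 0) (l : Idx N → ℂ) (i : ℕ) (β e₁ e₂ : ℂ) :
    Commute (xPlus N ℓ k i e₁) (vertexOp N ℓ k l β e₂) := by
  have key : ∀ f ∈ ghostFields N, ∀ e, Commute (normalExp N ℓ k f e) (vertexOp N ℓ k l β e₂) :=
    fun f hf e => normalExp_commute_vertexOp hN hℓ hk0 hk l β hf e e₂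
  unfold xPlus
  split_ifs
  · rw [Pi.smul_apply, Finset.sum_apply]
    exact (Commute.sum_left _ _ _ fun j _ => key _ (xPlusN_mem j) _).smul_left _
  · rw [Pi.smul_apply, zMul, Finset.sum_apply]
    refine (Commute.sum_left _ _ _ fun j _ => ?_).smul_left _
    exact Commute.sub_left (R := Module.End ℂ (Fock N)) (key _ (xPlus1_mem i j) _) (key _ (xPlus2_mem i j) _)

/-- Every summand is of type a_+ or a_-, and both types satisfy the same relation with the same t;
linear combinations and the factor 1/z preserve it. -/
theorem xMinus_exchanges (hN : 2 ≤ N) (hℓ : ℓ.re < 0) (hk0 : k + N - 1 ≠ 0)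
    (hk : ∀ m : ℤ, m ≠ 0 → qInt ℓ ((k + N - 1) * m) ≠ 0) (l : Idx N → ℂ) (i : Idx N) :
    Exchanges (vertexOp N ℓ k l (-((k + N - 1) / 2))) (qPow ℓ (l i)) (xMinus N ℓ k i) := by
  have hM : ∀ {f}, HasMatterPart (aM N ℓ i (-((k + N - 1) / 2))) f → Exchanges _ _ _ :=
    fun hf => exchanges_of_aM hN hℓ hk0 hk l _ i hf
  have hP : ∀ {f}, HasMatterPart (aP N ℓ i ((k + N - 1) / 2)) f → Exchanges _ _ _ :=
    fun hf => exchanges_of_aP hN hℓ hk0 hk l _ i hf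
  unfold xMinus
  split_ifs with hi
  · rw [hi] at hM hP
    refine ((Exchanges.sum fun j _ => (Exchanges.add (hM (xMinusN1_matter_aM j)).neg
      ?_).smul _).translate _).smul _
    exact (xMinusN2_matter j).elim hM hP
  · refine ((((Exchanges.sum fun j hj => ?_).add ?_).sub (Exchanges.sum fun j hj => ?_)).translate
      _).smul _ |>.add ((hP (xMinus0_matter_aP _)).smul _)
    · rw [Finset.mem_Icc] at hj
      exact (hM (xMinus1_matter_aM (by omega))).sub (hM (xMinus2_matter_aM (by omega)))
    · exact (hM (xMinus1_matter_aM le_rfl)).sub (hP (xMinus2_matter_aP le_rfl))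
    · rw [Finset.mem_Icc] at hj
      exact (hP (xMinus1_matter_aP (by omega))).sub (hP (xMinus2_matter_aP (by omega)))

end Relations

end SuperFock

/-! ### The proposition. -/

theorem mainTheorem10 (N : ℕ) (hN : 2 ≤ N) (q ℓ k : ℂ) (hq0 : 0 < ‖q‖) (hq1 : ‖q‖ < 1)
    (hlog : Complex.exp ℓ = q)
    (hk : ∀ m : ℤ, m ≠ 0 → SuperFock.qInt ℓ ((k + N - 1) * m) ≠ 0)
    (l : SuperFock.Idx N → ℂ) (i : SuperFock.Idx N) :
    (∀ β : ℂ, ∀ m : ℤ, m ≠ 0 →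
      (fun e => SuperFock.h N ℓ k i m * SuperFock.vertexOp N ℓ k l β e
          - SuperFock.vertexOp N ℓ k l β e * SuperFock.h N ℓ k i m) =
        (SuperFock.qInt ℓ (l i * m) / m
            * SuperFock.qPow ℓ (-(β + ((N : ℂ) - 1) / 2) * |m|)) •
          SuperFock.zMul (m : ℂ) (SuperFock.vertexOp N ℓ k l β)) ∧
    (∀ β : ℂ,
      (fun e => SuperFock.h N ℓ k i 0 * SuperFock.vertexOp N ℓ k l β e
          - SuperFock.vertexOp N ℓ k l β e * SuperFock.h N ℓ k i 0) =
        l i • SuperFock.vertexOp N ℓ k l β) ∧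
    (∀ β : ℂ,
      SuperFock.prod₁₂ (SuperFock.xPlus N ℓ k i) (SuperFock.vertexOp N ℓ k l β)
        - SuperFock.prod₂₁ (SuperFock.vertexOp N ℓ k l β) (SuperFock.xPlus N ℓ k i) = 0) ∧
    SuperFock.z₁Mul
          (SuperFock.prod₁₂ (SuperFock.xMinus N ℓ k i) (SuperFock.vertexOp N ℓ k l (-((k + N - 1) / 2))))
        - SuperFock.qPow ℓ (l i) • SuperFock.z₂Mul
          (SuperFock.prod₁₂ (SuperFock.xMinus N ℓ k i) (SuperFock.vertexOp N ℓ k l (-((k + N - 1) / 2)))) =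
      SuperFock.qPow ℓ (l i) • SuperFock.z₁Mul
          (SuperFock.prod₂₁ (SuperFock.vertexOp N ℓ k l (-((k + N - 1) / 2))) (SuperFock.xMinus N ℓ k i))
        - SuperFock.z₂Mul
          (SuperFock.prod₂₁ (SuperFock.vertexOp N ℓ k l (-((k + N - 1) / 2))) (SuperFock.xMinus N ℓ k i)) := by
  -- |q| = exp(Re ℓ), so |q| < 1 says Re ℓ < 0 for any choice of the logarithm.
  have hℓ : ℓ.re < 0 := by
    rw [← hlog, Complex.norm_exp, Real.exp_lt_one_iff] at hq1
    exact hq1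
  -- Otherwise `hk` at m = 1 would assert [0] ≠ 0.
  have hk0 : k + N - 1 ≠ 0 := by
    intro h0
    refine hk 1 one_ne_zero ?_
    rw [h0, zero_mul, SuperFock.qInt, neg_zero, sub_self, zero_div]
  refine ⟨fun β m hm => funext fun e => SuperFock.h_lie_vertexOp hN hℓ hk l i β hm e,
    fun β => funext fun e => SuperFock.h_zero_lie_vertexOp hN hk0 l i β e,
    fun β => funext fun e₁ => funext fun e₂ => sub_eq_zero.2
      (SuperFock.xPlus_commute_vertexOp hN hℓ hk0 hk l i β e₁ e₂).eq,
    funext fun e₁ => funext fun e₂ => SuperFock.xMinus_exchanges hN hℓ hk0 hk l i e₁ e₂⟩
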